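/- **Theorem (Mellin transform of $\Phi_{p,q}^{\lambda;\sigma,\tau}$).** For $\lambda>0$ let $E_\lambda(x)=\sum_{n\ge 0}\frac{x^n}{\Gamma(\lambda n+1)}$ be the Mittag-Leffler function. Let $B$ be the classical beta function, and let $\Phi(a,c;z)=\sum_{n\ge0}\frac{(a)_n}{(c)_n}\frac{z^n}{n!}$ be the classical confluent hypergeometric function. For $p,q,\sigma,\tau>0$ put $$B_{p,q}^{\lambda;\sigma,\tau}(a,b)=\int_0^1 t^{a-1}(1-t)^{b-1}E_\lambda\!\left(-\frac{p}{t^\sigma}\right)E_\lambda\!\left(-\frac{q}{(1-t)^\tau}\right)dt,$$ $$\Phi_{p,q}^{\lambda;\sigma,\tau}(\eta_2;\eta_3;z)=\sum_{n=0}^\infty \frac{B_{p,q}^{\lambda;\sigma,\tau}(\eta_2+n,\eta_3-\eta_2)}{B(\eta_2,\eta_3-\eta_2)}\frac{z^n}{n!}.$$ Let $0<\lambda\le 2$, $\sigma,\tau>0$, let $\eta_2,\eta_3,z\in\mathbb C$ with $\Re(\eta_3)>\Re(\eta_2)>0$, and let $r,s\in\mathbb C$ with $\Re(r)>0$, $\Re(s)>0$.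 If $\lambda\neq 1$, assume also $\Re(r)<1$ and $\Re(s)<1$. 1. For all $p,q>0$ the integrals and the series defining $\Phi_{p,q}^{\lambda;\sigma,\tau}(\eta_2;\eta_3;z)$ converge absolutely. 2. If $\lambda<2$, the double Mellin integral $$M=\int_0^\infty\!\!\int_0^\infty p^{r-1}q^{s-1}\,\Phi_{p,q}^{\lambda;\sigma,\tau}(\eta_2;\eta_3;z)\,dp\,dq$$ converges absolutely. 3. If $\lambda<2$, or if $\lambda=2$ and the double integral $M$ converges absolutely, and if $\sin(\pi r)\ne0$ and $\sin(\pi s)\neq 0$, then $$M=\frac{\pi^2}{\sin(\pi r)\sin(\pi s)\,\Gamma(1-r\lambda)\,\Gamma(1-s\lambda)}\;\frac{B(\eta_2+\sigma r,\;\eta_3+\tau s-\eta_2)}{B(\eta_2,\eta_3-\eta_2)}\;\Phi(\eta_2+\sigma r,\;\eta_3+\sigma r+\tau s;\;z),$$ where $1/\Gamma$ is understood to be $0$ at the poles of $\Gamma$. 4. If $\lambda=1$, then for all such $r,s$ (integers included) the same formula holds with the prefactor replaced by its continuous extension $\Gamma(r)\Gamma(s)$. -/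

import Mathlib

/-- The classical Mittag-Leffler function `E_lam(x) = ∑ xⁿ / Γ(lam n + 1)`. -/
noncomputable def mittagLeffler (lam : ℝ) (x : ℂ) : ℂ :=
  ∑' n : ℕ, x ^ n / Complex.Gamma ((lam : ℂ) * (n : ℂ) + 1)

/-- The integrand of the extended beta function:
`t^(a-1) (1-t)^(b-1) E_lam(-p / t^σ) E_lam(-q / (1-t)^τ)`. -/
noncomputable def extBetaIntegrand (lam σ τ : ℝ) (p q a b : ℂ) (t : ℝ) : ℂ :=
  (t : ℂ) ^ (a - 1) * (1 - (t : ℂ)) ^ (b - 1) *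
    mittagLeffler lam (-(p / ((t ^ σ : ℝ) : ℂ))) *
    mittagLeffler lam (-(q / (((1 - t) ^ τ : ℝ) : ℂ)))

/-- The extended beta function `B_{p,q}^{lam;σ,τ}(a, b)`. -/
noncomputable def extBeta (lam σ τ : ℝ) (p q a b : ℂ) : ℂ :=
  ∫ t in (0 : ℝ)..1, extBetaIntegrand lam σ τ p q a b t

/-- The `n`-th term of the series defining the extended confluent hypergeometric function. -/
noncomputable def extConfluentTerm (lam σ τ : ℝ) (p q a c z : ℂ) (n : ℕ) : ℂ :=
  extBeta lam σ τ p q (a + (n : ℂ)) (c - a) / Complex.betaIntegral a (c - a) *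
    (z ^ n / (n.factorial : ℂ))

/-- The extended confluent hypergeometric function `Φ_{p,q}^{lam;σ,τ}(a; c; z)`. -/
noncomputable def extConfluent (lam σ τ : ℝ) (p q a c z : ℂ) : ℂ :=
  ∑' n : ℕ, extConfluentTerm lam σ τ p q a c z n

/-- The classical confluent hypergeometric function
`Φ(a; c; z) = ∑ (a)_n / (c)_n zⁿ / n!`. -/
noncomputable def confluent (a c z : ℂ) : ℂ :=
  ∑' n : ℕ, (ascPochhammer ℂ n).eval a / (ascPochhammer ℂ n).eval c *
    (z ^ n / (n.factorial : ℂ))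

/-- Absolute convergence of the double Mellin integral of `f` at `(r, s)`. -/
def DoubleMellinConvergent (f : ℝ → ℝ → ℂ) (r s : ℂ) : Prop :=
  MeasureTheory.IntegrableOn
    (fun x : ℝ × ℝ => (x.1 : ℂ) ^ (r - 1) * (x.2 : ℂ) ^ (s - 1) * f x.1 x.2)
    (Set.Ioi (0 : ℝ) ×ˢ Set.Ioi (0 : ℝ))

/-- The double Mellin transform
`∫₀^∞ ∫₀^∞ p^(r-1) q^(s-1) f(p, q) dp dq`. -/
noncomputable def doubleMellin (f : ℝ → ℝ → ℂ) (r s : ℂ) : ℂ :=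
  mellin (fun q : ℝ => mellin (fun p : ℝ => f p q) r) s

/-! Because `E_λ` is bounded on the negative axis for `λ ≤ 2`, the exponential series can be summed
under the beta integral, and `Φ_{p,q}` becomes `1/B(η₂, η₃-η₂)` times the integral over `(0,1)` of
`t^(η₂-1) (1-t)^(η₃-η₂-1) e^(zt) E_λ(-p/t^σ) E_λ(-q/(1-t)^τ)` (`extConfluent_eq_integral`). Here `p`
and `q` enter only through dilates of `x ↦ E_λ(-x)`, and dilation by `κ` multiplies a Mellin
transform by `κ^r`. The double transform is therefore the product of two one-variable transforms and
Euler's integral with exponents raised by `σr` and `τs`, that is, a beta function times a classical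
`Φ`. Since `t^σ` and `(1-t)^τ` are at most 1, the dilated kernels have uniformly bounded `L¹` norms,
so Fubini applies whenever `E_λ(-x)` has absolutely convergent transforms at `r` and `s`.

The analytic core is that for `λ < 2` and `0 < Re r < 1` this transform is `π / (sin(πr) Γ(1-λr))`.
It is found backwards, from the inverse Mellin integral. On vertical lines `1/Γ(1-λr)` grows
essentially like `e^(πλ|y|/2)` and `1/sin(πr)` decays like `e^(-π|y|)`, so `λ < 2` leaves
exponential decay. Moving the line left by one unit at a time picks up the terms `(-x)^N / Γ(λN+1)`,
and the remainder tends to 0: this is the Mellin–Barnes representation. Its absolute value bounds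
`E_λ(-x)` by a multiple of `x^(-c)` for every `c` in `(0,1)`, and Fourier inversion then yields the
transform itself. For `λ = 1` the kernel is `e^(-x)`, with transform `Γ(r)` on the whole right half
plane.

For `λ = 2` the kernel is `cos √x`, whose Mellin integral never converges absolutely, so Fubini is
not available. Damping by `e^(-ε√p) e^(-ε√q)` restores it, with explicit transforms continuous at `ε
= 0`; dominated convergence as `ε → 0`, using the assumed absolute convergence of `M`, gives the
formula. -/

open MeasureTheory Set Filter Topology

/-! ### The Mittag-Leffler series: convergence, continuity, special values -/

/-- An elementary superexponential lower bound for the Gamma function. -/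
theorem Real.inv_Gamma_add_one_le {T s : ℝ} (hT : 0 < T) (hs : 0 ≤ s) :
    (Real.Gamma (s + 1))⁻¹ ≤ Real.exp T * (T ^ s)⁻¹ := by
  have hlow : T ^ s * Real.exp (-T) ≤ Real.Gamma (s + 1) := by
    rw [Real.Gamma_eq_integral (by linarith)]
    have hint := Real.GammaIntegral_convergent (s := s + 1) (by linarith)
    have h1 : ∫ x in Ioi T, T ^ s * Real.exp (-x) = T ^ s * Real.exp (-T) := by
      rw [integral_const_mul, integral_exp_neg_Ioi]
    rw [← h1]
    have hsub : Ioi T ⊆ Ioi (0 : ℝ) := Ioi_subset_Ioi hT.le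
    calc ∫ x in Ioi T, T ^ s * Real.exp (-x)
        ≤ ∫ x in Ioi T, Real.exp (-x) * x ^ (s + 1 - 1) := by
          refine setIntegral_mono_on ((integrableOn_exp_neg_Ioi T).const_mul _)
            (hint.mono_set hsub) measurableSet_Ioi fun x hx => ?_
          rw [mul_comm, add_sub_cancel_right]
          have : T ^ s ≤ x ^ s := Real.rpow_le_rpow hT.le (le_of_lt hx) hs
          gcongr
      _ ≤ _ := by
          refine setIntegral_mono_set hint ?_ hsub.eventuallyLE
          refine (ae_restrict_iff' measurableSet_Ioi).2 (Eventually.of_forall fun x hx => ?_)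
          have : (0 : ℝ) < x := hx
          simp only [Pi.zero_apply]
          positivity
  have hpos : 0 < T ^ s * Real.exp (-T) := by positivity
  calc (Real.Gamma (s + 1))⁻¹ ≤ (T ^ s * Real.exp (-T))⁻¹ := inv_anti₀ hpos hlow
    _ = _ := by rw [mul_inv, Real.exp_neg, inv_inv, mul_comm]

/-- Taking `T = (2R)^(1/lam)` in the lower bound for `Γ` makes `T^(lam n) = (2R)^n`, which beats
`R^n` by a geometric factor uniformly on the disc. -/
theorem norm_mittagLeffler_term_le {lam R : ℝ} (hlam : 0 < lam) (hR : 0 < R) {x : ℂ}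
    (hx : ‖x‖ ≤ R) (n : ℕ) :
    ‖x ^ n / Complex.Gamma ((lam : ℂ) * (n : ℂ) + 1)‖ ≤
      Real.exp ((2 * R) ^ lam⁻¹) * (1 / 2) ^ n := by
  have hT : 0 < (2 * R) ^ lam⁻¹ := by positivity
  have h := Real.inv_Gamma_add_one_le hT (s := lam * n) (by positivity)
  have hc : (lam : ℂ) * (n : ℂ) + 1 = ((lam * n + 1 : ℝ) : ℂ) := by push_cast; ring
  have hG : 0 < Real.Gamma (lam * n + 1) := Real.Gamma_pos_of_pos (by positivity)
  rw [hc, Complex.Gamma_ofReal, norm_div, norm_pow, Complex.norm_real, Real.norm_of_nonneg hG.le,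
    div_eq_mul_inv]
  have hp : ((2 * R) ^ lam⁻¹) ^ (lam * n) = (2 * R) ^ n := by
    rw [← Real.rpow_mul (by positivity), ← mul_assoc, inv_mul_cancel₀ hlam.ne', one_mul,
      Real.rpow_natCast]
  rw [hp] at h
  calc ‖x‖ ^ n * (Real.Gamma (lam * n + 1))⁻¹
      ≤ R ^ n * (Real.exp ((2 * R) ^ lam⁻¹) * ((2 * R) ^ n)⁻¹) := by gcongr
    _ = _ := by
      rw [mul_pow, one_div, inv_pow]
      field_simp

theorem mittagLeffler_summable {lam : ℝ} (hlam : 0 < lam) (x : ℂ) :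
    Summable fun n : ℕ => x ^ n / Complex.Gamma ((lam : ℂ) * (n : ℂ) + 1) :=
  Summable.of_norm_bounded (summable_geometric_two.mul_left _)
    (norm_mittagLeffler_term_le hlam (R := ‖x‖ + 1) (by positivity) (by linarith))

theorem mittagLeffler_continuous {lam : ℝ} (hlam : 0 < lam) : Continuous (mittagLeffler lam) := by
  rw [continuous_iff_continuousAt]
  intro x
  have : ContinuousOn (mittagLeffler lam) (Metric.ball 0 (‖x‖ + 1)) := by
    refine continuousOn_tsum (fun n => by fun_prop)
      (summable_geometric_two.mul_left (Real.exp ((2 * (‖x‖ + 1)) ^ lam⁻¹))) fun n y hy => ?_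
    exact norm_mittagLeffler_term_le hlam (by positivity) (by simpa using (mem_ball_zero_iff.1 hy).le) n
  exact this.continuousAt (Metric.isOpen_ball.mem_nhds (by simp))

theorem mittagLeffler_one (x : ℂ) : mittagLeffler 1 x = Complex.exp x := by
  rw [mittagLeffler, Complex.exp_eq_exp_ℂ, NormedSpace.exp_eq_tsum_div]
  congr 1; ext n
  rw [Complex.ofReal_one, one_mul, Complex.Gamma_nat_eq_factorial]

theorem mittagLeffler_two_neg_sq (x : ℂ) : mittagLeffler 2 (-x ^ 2) = Complex.cos x := by
  rw [mittagLeffler, Complex.cos_eq_tsum]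
  congr 1; ext n
  rw [← Complex.Gamma_nat_eq_factorial, neg_pow, ← pow_mul]
  push_cast
  rfl

/-! ### Contour shifts under exponential decay -/

theorem integrable_exp_neg_mul_abs {δ : ℝ} (hδ : 0 < δ) :
    Integrable fun y : ℝ => Real.exp (-(δ * |y|)) := by
  rw [← integrableOn_univ, ← Iic_union_Ioi (a := (0 : ℝ))]
  refine IntegrableOn.union ?_ ?_
  · refine (integrableOn_exp_mul_Iic hδ 0).congr_fun (fun y hy => ?_) measurableSet_Iic
    simp only [abs_of_nonpos (mem_Iic.1 hy)]; ring_nf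
  · refine (integrableOn_exp_mul_Ioi (neg_lt_zero.2 hδ) 0).congr_fun (fun y hy => ?_)
      measurableSet_Ioi
    simp only [abs_of_pos (mem_Ioi.1 hy)]; ring_nf

theorem Continuous.integrable_of_norm_le_exp_neg {f : ℝ → ℂ} (hf : Continuous f) {C δ : ℝ}
    (hδ : 0 < δ) (hb : ∀ y : ℝ, 1 ≤ |y| → ‖f y‖ ≤ C * Real.exp (-(δ * |y|))) : Integrable f := by
  obtain ⟨K, hK⟩ := isCompact_Icc.exists_bound_of_continuousOn (s := Icc (-1 : ℝ) 1) hf.continuousOn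
  refine Integrable.mono' ((integrable_exp_neg_mul_abs hδ).const_mul (|C| + |K| * Real.exp δ))
    hf.aestronglyMeasurable (Eventually.of_forall fun y => ?_)
  have hE := Real.exp_pos (-(δ * |y|))
  rcases le_or_gt 1 |y| with h | h
  · refine (hb y h).trans ?_
    gcongr
    have := le_abs_self C
    have : 0 ≤ |K| * Real.exp δ := by positivity
    linarith
  · calc ‖f y‖ ≤ |K| := (hK y (abs_le.1 h.le)).trans (le_abs_self K)
      _ = |K| * Real.exp δ * Real.exp (-δ) := by rw [mul_assoc, ← Real.exp_add]; simp
      _ ≤ |K| * Real.exp δ * Real.exp (-(δ * |y|)) := by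
        gcongr; nlinarith
      _ ≤ _ := by gcongr; linarith [abs_nonneg C]

theorem norm_intervalIntegral_le_mul_sub {f : ℝ → ℂ} {a b B : ℝ} (hab : a ≤ b)
    (h : ∀ u ∈ Icc a b, ‖f u‖ ≤ B) : ‖∫ u in a..b, f u‖ ≤ B * (b - a) := by
  rw [← abs_of_nonneg (sub_nonneg.2 hab)]
  refine intervalIntegral.norm_integral_le_of_norm_le_const fun u hu => h u ?_
  rw [uIoc_of_le hab] at hu
  exact Ioc_subset_Icc_self hu

/-- Shifting a vertical contour inside a strip of holomorphy with exponential decay. -/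
theorem integral_vertical_eq_of_norm_le_exp_neg {H : ℂ → ℂ} {a b C δ : ℝ} (hab : a ≤ b)
    (hδ : 0 < δ) (hH : DifferentiableOn ℂ H (Complex.re ⁻¹' Icc a b))
    (hb : ∀ u ∈ Icc a b, ∀ y : ℝ, 1 ≤ |y| → ‖H (u + y * Complex.I)‖ ≤ C * Real.exp (-(δ * |y|))) :
    ∫ y : ℝ, H (a + y * Complex.I) = ∫ y : ℝ, H (b + y * Complex.I) := by
  have hline : ∀ u ∈ Icc a b, Integrable fun y : ℝ => H (u + y * Complex.I) := fun u hu => by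
    refine Continuous.integrable_of_norm_le_exp_neg ?_ hδ (hb u hu)
    exact hH.continuousOn.comp_continuous (by fun_prop) fun y => by simpa using hu
  have hv : ∀ u ∈ Icc a b, Tendsto (fun T : ℝ => ∫ y in (-T)..T, H (u + y * Complex.I)) atTop
      (𝓝 (∫ y : ℝ, H (u + y * Complex.I))) := fun u hu =>
    intervalIntegral_tendsto_integral (hline u hu) tendsto_neg_atTop_atBot tendsto_id
  have hdecay : Tendsto (fun T : ℝ => C * Real.exp (-(δ * T)) * (b - a)) atTop (𝓝 0) := by
    have h0 : Tendsto (fun T : ℝ => Real.exp (-(δ * T))) atTop (𝓝 0) :=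
      Real.tendsto_exp_neg_atTop_nhds_zero.comp (tendsto_id.const_mul_atTop hδ)
    simpa using (h0.const_mul C).mul_const (b - a)
  -- The sign `ε` treats the top and bottom edges of the rectangle together; both vanish as its
  -- height grows.
  have hh : ∀ ε : ℝ, |ε| = 1 → Tendsto (fun T : ℝ => ∫ u in a..b, H (u + (ε * T : ℝ) * Complex.I))
      atTop (𝓝 0) := fun ε hε => by
    refine squeeze_zero_norm' ?_ hdecay
    filter_upwards [eventually_ge_atTop 1] with T hT
    refine norm_intervalIntegral_le_mul_sub hab fun u hu => ?_
    have habs : |ε * T| = T := by rw [abs_mul, hε, one_mul, abs_of_pos (by linarith)]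
    have := hb u hu (ε * T) (by rw [habs]; exact hT)
    rwa [habs] at this
  have hrect : ∀ T : ℝ, (∫ u in a..b, H (u + (-1 * T : ℝ) * Complex.I)) -
      (∫ u in a..b, H (u + (1 * T : ℝ) * Complex.I)) +
      Complex.I • (∫ y in (-T)..T, H (b + y * Complex.I)) -
      Complex.I • (∫ y in (-T)..T, H (a + y * Complex.I)) = 0 := fun T => by
    have := Complex.integral_boundary_rect_eq_zero_of_differentiableOn H
      ⟨a, -T⟩ ⟨b, T⟩ (hH.mono fun z hz => by
        have := hz.1
        simpa [uIcc_of_le hab] using this)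
    simpa using this
  have hlim := (((hh (-1) (by simp)).sub (hh 1 (by simp))).add
    ((hv b (right_mem_Icc.2 hab)).const_smul Complex.I)).sub
    ((hv a (left_mem_Icc.2 hab)).const_smul Complex.I)
  have h0 := tendsto_nhds_unique hlim (tendsto_const_nhds.congr fun T => (hrect T).symm)
  rw [sub_zero, zero_add, ← smul_sub, smul_eq_zero] at h0
  exact (sub_eq_zero.1 (h0.resolve_left Complex.I_ne_zero)).symm

/-! ### Bounds for the sine and a Poisson formula on a strip -/

theorem Complex.norm_sin_add_mul_I_sq (x y : ℝ) :
    ‖Complex.sin (x + y * Complex.I)‖ ^ 2 = Real.sin x ^ 2 + Real.sinh y ^ 2 := by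
  rw [Complex.sin_add_mul_I, ← Complex.ofReal_sin, ← Complex.ofReal_cos, ← Complex.ofReal_sinh,
    ← Complex.ofReal_cosh, ← Complex.ofReal_mul, ← Complex.ofReal_mul, Complex.sq_norm,
    Complex.normSq_add_mul_I]
  nlinarith [Real.sin_sq_add_cos_sq x, Real.cosh_sq y]

theorem Complex.abs_sinh_le_norm_sin (x y : ℝ) :
    |Real.sinh y| ≤ ‖Complex.sin (x + y * Complex.I)‖ := by
  refine abs_le_of_sq_le_sq ?_ (norm_nonneg _)
  rw [Complex.norm_sin_add_mul_I_sq]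
  linarith [sq_nonneg (Real.sin x)]

theorem Real.exp_abs_le_cosh (y : ℝ) : Real.exp |y| / 2 ≤ Real.cosh y := by
  rw [← Real.cosh_abs, Real.cosh_eq]
  have := Real.exp_pos (-|y|)
  linarith

theorem Real.exp_abs_le_abs_sinh {y : ℝ} (hy : 1 ≤ |y|) : Real.exp |y| / 4 ≤ |Real.sinh y| := by
  rw [Real.abs_sinh, Real.sinh_eq]
  have h1 : Real.exp (-|y|) ≤ 1 := Real.exp_le_one_iff.2 (by linarith)
  have h2 := Real.add_one_le_exp |y|
  linarith

theorem integral_inv_cosh_pi_mul : ∫ y : ℝ, (Real.cosh (Real.pi * y))⁻¹ = 1 := by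
  have hd : ∀ y : ℝ, HasDerivAt (fun y => Real.pi⁻¹ * Real.arctan (Real.sinh (Real.pi * y)))
      (Real.cosh (Real.pi * y))⁻¹ y := fun y => by
    have h := ((((hasDerivAt_id y).const_mul Real.pi).sinh).arctan).const_mul Real.pi⁻¹
    refine h.congr_deriv ?_
    have := Real.cosh_sq (Real.pi * y)
    have hc := Real.cosh_pos (Real.pi * y)
    simp only [id]
    rw [show 1 + Real.sinh (Real.pi * y) ^ 2 = Real.cosh (Real.pi * y) ^ 2 by linarith]
    field_simp
  have htop : Tendsto (fun y : ℝ => Real.pi⁻¹ * Real.arctan (Real.sinh (Real.pi * y))) atTop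
      (𝓝 (Real.pi⁻¹ * (Real.pi / 2))) := by
    refine Tendsto.const_mul _ ?_
    exact (tendsto_nhdsWithin_iff.1 Real.tendsto_arctan_atTop).1.comp
      (Real.sinhOrderIso.tendsto_atTop.comp (tendsto_id.const_mul_atTop Real.pi_pos))
  have hbot : Tendsto (fun y : ℝ => Real.pi⁻¹ * Real.arctan (Real.sinh (Real.pi * y))) atBot
      (𝓝 (Real.pi⁻¹ * (-(Real.pi / 2)))) := by
    refine Tendsto.const_mul _ ?_
    exact (tendsto_nhdsWithin_iff.1 Real.tendsto_arctan_atBot).1.comp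
      (Real.sinhOrderIso.tendsto_atBot.comp (tendsto_id.const_mul_atBot Real.pi_pos))
  have hint : Integrable fun y : ℝ => (Real.cosh (Real.pi * y))⁻¹ := by
    refine ((integrable_exp_neg_mul_abs Real.pi_pos).const_mul 2).mono' ?_
      (Eventually.of_forall fun y => ?_)
    · have : Continuous fun y : ℝ => (Real.cosh (Real.pi * y))⁻¹ :=
        (Real.continuous_cosh.comp (by fun_prop)).inv₀ fun y => (Real.cosh_pos _).ne'
      exact this.aestronglyMeasurable
    · have h := Real.exp_abs_le_cosh (Real.pi * y)
      rw [abs_mul, abs_of_pos Real.pi_pos] at h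
      rw [Real.norm_of_nonneg (inv_nonneg.2 (Real.cosh_pos _).le), Real.exp_neg]
      calc (Real.cosh (Real.pi * y))⁻¹ ≤ (Real.exp (Real.pi * |y|) / 2)⁻¹ :=
            inv_anti₀ (by positivity) h
        _ = _ := by rw [inv_div]; ring
  rw [integral_of_hasDerivAt_of_tendsto hd hint hbot htop]
  field_simp
  ring

/-- The Poisson formula at the centre of a strip of width one. -/
theorem integral_strip_div_cosh {G : ℂ → ℂ} (hG : Differentiable ℂ G) {C θ : ℝ} (hθ : 0 ≤ θ)
    (hθπ : θ < Real.pi)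
    (hb : ∀ u ∈ Icc (-(1 / 2) : ℝ) (1 / 2), ∀ y : ℝ,
      ‖G (u + y * Complex.I)‖ ≤ C * Real.exp (θ * |y|)) :
    ∫ y : ℝ, (G ((1 / 2 : ℝ) + y * Complex.I) + G ((-(1 / 2) : ℝ) + y * Complex.I)) /
      (Real.cosh (Real.pi * y) : ℂ) = 2 * G 0 := by
  set S : ℂ → ℂ := fun r => Complex.sin (Real.pi * r) with hS
  have hSd : Differentiable ℂ S := by fun_prop
  have hdG : Differentiable ℂ (dslope G 0) :=
    differentiableOn_univ.1 ((Complex.differentiableOn_dslope univ_mem).2 hG.differentiableOn)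
  have hdS : Differentiable ℂ (dslope S 0) :=
    differentiableOn_univ.1 ((Complex.differentiableOn_dslope univ_mem).2 hSd.differentiableOn)
  have hS0 : S 0 = 0 := by simp [hS]
  have hSline : ∀ u y : ℝ, S (u + y * Complex.I) =
      Complex.sin ((Real.pi * u : ℝ) + (Real.pi * y : ℝ) * Complex.I) := fun u y => by
    simp only [hS]; congr 1; push_cast; ring
  -- `H` is `(G - G 0) / sin(πr)` with the singularity at 0 removed. It is holomorphic on the closed
  -- strip, so its integrals over the two boundary lines agree. There the sine equals `±cosh(πy)`,
  -- and with `∫ 1/cosh(πy) = 1` this equality is the claim.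
  set H : ℂ → ℂ := fun r => dslope G 0 r / dslope S 0 r with hH
  have hHne : ∀ r, r ≠ 0 → H r = (G r - G 0) / S r := fun r hr => by
    simp only [hH, dslope_of_ne _ hr, slope_def_field, hS0, sub_zero]
    field_simp
  have hSne : ∀ r ∈ Complex.re ⁻¹' Icc (-(1 / 2) : ℝ) (1 / 2), dslope S 0 r ≠ 0 := by
    intro r hr
    by_cases h0 : r = 0
    · subst h0
      have : HasDerivAt S (Complex.cos (Real.pi * 0) * Real.pi) 0 := by
        have := ((hasDerivAt_id (0 : ℂ)).const_mul (Real.pi : ℂ)).csin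
        simpa [hS] using this
      rw [dslope_same, this.deriv]
      simp [Real.pi_ne_zero]
    · rw [dslope_of_ne _ h0, slope_def_field, hS0, sub_zero, sub_zero]
      refine div_ne_zero (fun hz => ?_) h0
      obtain ⟨k, hk⟩ := Complex.sin_eq_zero_iff.1 hz
      have hrk : r = k := by
        have hpi : (Real.pi : ℂ) ≠ 0 := by exact_mod_cast Real.pi_ne_zero
        exact mul_left_cancel₀ hpi (by rw [hk]; ring)
      have h1 := hr.1
      have h2 := hr.2
      rw [hrk, Complex.intCast_re] at h1 h2
      have hk0 : k = 0 := by
        have h3 : (-1 : ℝ) < k := by linarith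
        have h4 : (k : ℝ) < 1 := by linarith
        have h5 : (-1 : ℤ) < k := by exact_mod_cast h3
        have h6 : k < (1 : ℤ) := by exact_mod_cast h4
        omega
      exact h0 (by rw [hrk, hk0]; simp)
  have hHd : DifferentiableOn ℂ H (Complex.re ⁻¹' Icc (-(1 / 2) : ℝ) (1 / 2)) := fun r hr =>
    ((hdG r).div (hdS r) (hSne r hr)).differentiableWithinAt
  have hHb : ∀ u ∈ Icc (-(1 / 2) : ℝ) (1 / 2), ∀ y : ℝ, 1 ≤ |y| →
      ‖H (u + y * Complex.I)‖ ≤ 8 * C * Real.exp (-((Real.pi - θ) * |y|)) := by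
    intro u hu y hy
    have hne : (u + y * Complex.I : ℂ) ≠ 0 := fun h => by
      have := congrArg Complex.im h
      simp at this
      simp [this] at hy
      linarith
    have hC0 : 0 ≤ C := by
      have := (norm_nonneg _).trans (hb 0 (by norm_num) 0)
      simpa using this
    have h0 : ‖G 0‖ ≤ C := by simpa using hb 0 (by norm_num) 0
    have hπy : 1 ≤ |Real.pi * y| := by
      rw [abs_mul, abs_of_pos Real.pi_pos]
      nlinarith [Real.pi_gt_three]
    have hs : Real.exp (Real.pi * |y|) / 4 ≤ ‖S (u + y * Complex.I)‖ := by
      rw [hSline]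
      refine le_trans ?_ (Complex.abs_sinh_le_norm_sin _ _)
      have := Real.exp_abs_le_abs_sinh hπy
      rwa [abs_mul, abs_of_pos Real.pi_pos] at this
    have hone : 1 ≤ Real.exp (θ * |y|) := Real.one_le_exp (by positivity)
    rw [hHne _ hne, norm_div]
    calc ‖G (u + y * Complex.I) - G 0‖ / ‖S (u + y * Complex.I)‖
        ≤ (2 * C * Real.exp (θ * |y|)) / (Real.exp (Real.pi * |y|) / 4) := by
          refine div_le_div₀ (by positivity) ?_ (by positivity) hs
          refine (norm_sub_le _ _).trans ?_
          have := hb u hu y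
          nlinarith
      _ = _ := by
          rw [show -((Real.pi - θ) * |y|) = θ * |y| - Real.pi * |y| by ring, Real.exp_sub]
          field_simp
          ring
  have key := integral_vertical_eq_of_norm_le_exp_neg (by norm_num) (sub_pos.2 hθπ) hHd hHb
  have hcosh : ∀ y : ℝ, (Real.cosh (Real.pi * y) : ℂ) ≠ 0 := fun y => by
    exact_mod_cast (Real.cosh_pos _).ne'
  have hsp : ∀ y : ℝ, S ((1 / 2 : ℝ) + y * Complex.I) = (Real.cosh (Real.pi * y) : ℂ) := fun y => by
    rw [hSline, Complex.sin_add_mul_I, ← Complex.ofReal_sin, ← Complex.ofReal_cos]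
    rw [show Real.pi * (1 / 2) = Real.pi / 2 by ring, Real.sin_pi_div_two, Real.cos_pi_div_two]
    simp
  have hsm : ∀ y : ℝ, S ((-(1 / 2) : ℝ) + y * Complex.I) = -(Real.cosh (Real.pi * y) : ℂ) :=
    fun y => by
    rw [hSline, Complex.sin_add_mul_I, ← Complex.ofReal_sin, ← Complex.ofReal_cos]
    rw [show Real.pi * -(1 / 2) = -(Real.pi / 2) by ring, Real.sin_neg, Real.cos_neg,
      Real.sin_pi_div_two, Real.cos_pi_div_two]
    simp
  have hnz : ∀ u : ℝ, u ≠ 0 → ∀ y : ℝ, (u + y * Complex.I : ℂ) ≠ 0 := fun u hu y h => hu (by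
    simpa using congrArg Complex.re h)
  have hcont : Continuous fun y : ℝ => (Real.cosh (Real.pi * y) : ℂ) := by
    have := Real.continuous_cosh
    fun_prop
  have hline : ∀ u ∈ Icc (-(1 / 2) : ℝ) (1 / 2),
      Integrable fun y : ℝ => G (u + y * Complex.I) / (Real.cosh (Real.pi * y) : ℂ) := by
    intro u hu
    refine Continuous.integrable_of_norm_le_exp_neg (C := 2 * C)
      (Continuous.div (hG.continuous.comp (by fun_prop)) hcont hcosh) (sub_pos.2 hθπ)
      fun y _ => ?_
    have h := Real.exp_abs_le_cosh (Real.pi * y)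
    rw [abs_mul, abs_of_pos Real.pi_pos] at h
    rw [norm_div, Complex.norm_real, Real.norm_of_nonneg (Real.cosh_pos _).le]
    calc _ ≤ (C * Real.exp (θ * |y|)) / (Real.exp (Real.pi * |y|) / 2) :=
          div_le_div₀ ((norm_nonneg _).trans (hb u hu y)) (hb u hu y) (by positivity) h
      _ = _ := by
          rw [show -((Real.pi - θ) * |y|) = θ * |y| - Real.pi * |y| by ring, Real.exp_sub]
          field_simp
  have hconst : ∫ y : ℝ, (Real.cosh (Real.pi * y) : ℂ)⁻¹ = 1 := by
    have := integral_ofReal (𝕜 := ℂ) (μ := volume) (f := fun y : ℝ => (Real.cosh (Real.pi * y))⁻¹)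
    rw [integral_inv_cosh_pi_mul] at this
    simpa using this
  have hcint : Integrable fun y : ℝ => (Real.cosh (Real.pi * y) : ℂ)⁻¹ := by
    by_contra h
    rw [integral_undef h] at hconst
    exact zero_ne_one hconst
  have hp := hline (1 / 2) (by norm_num)
  have hm := hline (-(1 / 2)) (by norm_num)
  have e1 : ∀ y : ℝ, H ((1 / 2 : ℝ) + y * Complex.I) =
      G ((1 / 2 : ℝ) + y * Complex.I) / (Real.cosh (Real.pi * y) : ℂ) -
        G 0 * (Real.cosh (Real.pi * y) : ℂ)⁻¹ := fun y => by
    rw [hHne _ (hnz _ (by norm_num) y), hsp, sub_div, ← div_eq_mul_inv]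
  have e2 : ∀ y : ℝ, H ((-(1 / 2) : ℝ) + y * Complex.I) =
      G 0 * (Real.cosh (Real.pi * y) : ℂ)⁻¹ -
      G ((-(1 / 2) : ℝ) + y * Complex.I) / (Real.cosh (Real.pi * y) : ℂ) := fun y => by
    rw [hHne _ (hnz _ (by norm_num) y), hsm, div_neg, sub_div, ← div_eq_mul_inv (G 0)]
    ring
  simp only [e1, e2] at key
  rw [integral_sub (hcint.const_mul _) hm, integral_sub hp (hcint.const_mul _),
    integral_const_mul, hconst] at key
  simp only [add_div]
  rw [integral_add hp hm]
  linear_combination -key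

/-! ### Growth of `1/Γ` along vertical lines -/

theorem Complex.norm_Gamma_one_half_add_mul_I_sq (v : ℝ) :
    ‖Complex.Gamma ((1 / 2 : ℝ) + v * Complex.I)‖ ^ 2 = Real.pi / Real.cosh (Real.pi * v) := by
  have h := Complex.Gamma_mul_Gamma_one_sub ((1 / 2 : ℝ) + v * Complex.I)
  have hconj : (1 : ℂ) - ((1 / 2 : ℝ) + v * Complex.I) =
      (starRingEnd ℂ) ((1 / 2 : ℝ) + v * Complex.I) := by
    apply Complex.ext <;> (simp; try norm_num)
  rw [hconj, Complex.Gamma_conj, Complex.mul_conj, Complex.normSq_eq_norm_sq] at h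
  have hsin : Complex.sin (Real.pi * ((1 / 2 : ℝ) + v * Complex.I)) =
      (Real.cosh (Real.pi * v) : ℂ) := by
    rw [show (Real.pi : ℂ) * ((1 / 2 : ℝ) + v * Complex.I) =
      (Real.pi / 2 : ℝ) + (Real.pi * v : ℝ) * Complex.I by push_cast; ring,
      Complex.sin_add_mul_I, ← Complex.ofReal_sin, ← Complex.ofReal_cos, Real.sin_pi_div_two,
      Real.cos_pi_div_two]
    simp
  rw [hsin] at h
  exact_mod_cast h

/-- A factorwise comparison in Euler's product: `|B + j + iv| / (B + j)` decreases in `B`. In the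
limit, `|Γ(A + iv)| / Γ(A)` is at least its value at `A = 1/2`, where the reflection formula makes
it explicit. -/
theorem Complex.norm_GammaSeq_mul_le {A : ℝ} (hA : 1 / 2 ≤ A) (v : ℝ) {n : ℕ} (hn : 0 < n) :
    ‖Complex.GammaSeq A n‖ * ‖Complex.GammaSeq ((1 / 2 : ℝ) + v * Complex.I) n‖ ≤
      ‖Complex.GammaSeq (1 / 2 : ℝ) n‖ * ‖Complex.GammaSeq (A + v * Complex.I) n‖ := by
  have hn' : (0 : ℝ) < n := by exact_mod_cast hn
  have hc : ∀ s : ℂ, ‖(n : ℂ) ^ s‖ = (n : ℝ) ^ s.re := fun s => by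
    rw [← Complex.ofReal_natCast, Complex.norm_cpow_eq_rpow_re_of_pos hn']
  have hnorm : ∀ s : ℂ, ‖Complex.GammaSeq s n‖ =
      (n : ℝ) ^ s.re * n.factorial / ∏ j ∈ Finset.range (n + 1), ‖s + j‖ := fun s => by
    rw [Complex.GammaSeq, norm_div, norm_mul, hc, norm_prod]
    simp
  have hne : ∀ B : ℝ, 1 / 2 ≤ B → ∀ y : ℝ, ∀ j : ℕ, 0 < ‖(B + y * Complex.I : ℂ) + j‖ :=
    fun B hB y j => norm_pos_iff.2 fun h => by
      have := congrArg Complex.re h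
      simp at this
      have : (0 : ℝ) ≤ j := by positivity
      linarith
  have hne0 : ∀ B : ℝ, 1 / 2 ≤ B → ∀ j : ℕ, ‖(B : ℂ) + j‖ = B + j := fun B hB j => by
    rw [← Complex.ofReal_natCast, ← Complex.ofReal_add, Complex.norm_real, Real.norm_of_nonneg]
    positivity
  rw [hnorm, hnorm, hnorm, hnorm, div_mul_div_comm, div_mul_div_comm, ← Finset.prod_mul_distrib,
    ← Finset.prod_mul_distrib]
  have hnum : (n : ℝ) ^ (A : ℂ).re * n.factorial *
      ((n : ℝ) ^ ((1 / 2 : ℝ) + v * Complex.I : ℂ).re * n.factorial) =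
      (n : ℝ) ^ ((1 / 2 : ℝ) : ℂ).re * n.factorial *
        ((n : ℝ) ^ (A + v * Complex.I : ℂ).re * n.factorial) := by
    simp; ring
  rw [hnum]
  refine div_le_div_of_nonneg_left (by positivity) ?_ ?_
  · refine Finset.prod_pos fun j _ => ?_
    rw [hne0 _ le_rfl]
    exact mul_pos (by positivity) (hne A hA v j)
  · refine Finset.prod_le_prod (fun j _ => by positivity) fun j _ => ?_
    rw [hne0 _ le_rfl, hne0 _ hA]
    refine le_of_sq_le_sq ?_ (by positivity)
    rw [mul_pow, mul_pow, Complex.sq_norm, Complex.sq_norm, Complex.normSq_apply,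
      Complex.normSq_apply]
    simp
    have hj : (0 : ℝ) ≤ j := by positivity
    have : (2⁻¹ + j : ℝ) ^ 2 ≤ (A + j) ^ 2 := by gcongr; linarith
    nlinarith [mul_le_mul_of_nonneg_right this (mul_self_nonneg v)]

theorem Complex.norm_inv_Gamma_le {A : ℝ} (hA : 1 / 2 ≤ A) (v : ℝ) :
    ‖(Complex.Gamma (A + v * Complex.I))⁻¹‖ ≤
      Real.exp (Real.pi / 2 * |v|) * (Real.Gamma A)⁻¹ := by
  have hlim := le_of_tendsto_of_tendsto
    ((Complex.GammaSeq_tendsto_Gamma A).norm.mul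
      (Complex.GammaSeq_tendsto_Gamma ((1 / 2 : ℝ) + v * Complex.I)).norm)
    ((Complex.GammaSeq_tendsto_Gamma (1 / 2 : ℝ)).norm.mul
      (Complex.GammaSeq_tendsto_Gamma (A + v * Complex.I)).norm)
    ((eventually_gt_atTop 0).mono fun n hn => Complex.norm_GammaSeq_mul_le hA v hn)
  have hGA : 0 < Real.Gamma A := Real.Gamma_pos_of_pos (by linarith)
  rw [Complex.Gamma_ofReal, Complex.Gamma_ofReal, Complex.norm_real, Complex.norm_real,
    Real.norm_of_nonneg hGA.le, Real.Gamma_one_half_eq, Real.norm_of_nonneg (by positivity)] at hlim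
  set g := ‖Complex.Gamma (A + v * Complex.I)‖
  have hsq := Complex.norm_Gamma_one_half_add_mul_I_sq v
  have hlow : √Real.pi * Real.exp (-(Real.pi / 2 * |v|)) ≤
      ‖Complex.Gamma ((1 / 2 : ℝ) + v * Complex.I)‖ := by
    refine le_of_sq_le_sq ?_ (norm_nonneg _)
    rw [hsq, mul_pow, Real.sq_sqrt Real.pi_pos.le, ← Real.exp_nat_mul,
      div_eq_mul_inv Real.pi (Real.cosh _)]
    refine mul_le_mul_of_nonneg_left ?_ Real.pi_pos.le
    rw [show ((2 : ℕ) : ℝ) * -(Real.pi / 2 * |v|) = -(Real.pi * |v|) by push_cast; ring,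
      Real.exp_neg]
    refine inv_anti₀ (Real.cosh_pos _) ?_
    rw [← Real.cosh_abs, abs_mul, abs_of_pos Real.pi_pos, Real.cosh_eq]
    have : Real.exp (-(Real.pi * |v|)) ≤ Real.exp (Real.pi * |v|) :=
      Real.exp_le_exp.2 (by have : 0 ≤ Real.pi * |v| := by positivity
                            linarith)
    linarith
  have hπ : 0 < √Real.pi := Real.sqrt_pos.2 Real.pi_pos
  have h1 : Real.Gamma A * Real.exp (-(Real.pi / 2 * |v|)) ≤ g := by
    have : √Real.pi * (Real.Gamma A * Real.exp (-(Real.pi / 2 * |v|))) ≤ √Real.pi * g := by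
      refine le_trans ?_ hlim
      nlinarith
    exact le_of_mul_le_mul_left this hπ
  rw [norm_inv]
  calc g⁻¹ ≤ (Real.Gamma A * Real.exp (-(Real.pi / 2 * |v|)))⁻¹ := inv_anti₀ (by positivity) h1
    _ = _ := by rw [mul_inv, Real.exp_neg, inv_inv, mul_comm]

/-- Growth of `1 / Γ` on the half plane `-1 ≤ Re w`. -/
theorem Complex.norm_inv_Gamma_le_pow {A : ℝ} (hA : -1 ≤ A) (v : ℝ) :
    ‖(Complex.Gamma (A + v * Complex.I))⁻¹‖ ≤
      (|A| + |v| + 2) ^ 3 * Real.exp (Real.pi / 2 * |v|) := by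
  have hrec := Complex.one_div_Gamma_eq_self_mul_one_div_Gamma_add_one
  set w : ℂ := A + v * Complex.I with hw
  -- Three steps of the recursion bring the real part to at least 2, where `Γ ≥ 1` on the real axis;
  -- they cost a cubic factor.
  have h3 : (Complex.Gamma w)⁻¹ = w * ((w + 1) * ((w + 2) * (Complex.Gamma (w + 3))⁻¹)) := by
    rw [hrec w, hrec (w + 1), hrec (w + 1 + 1)]
    ring_nf
  have hw0 : ‖w‖ ≤ |A| + |v| := by
    refine (norm_add_le _ _).trans ?_
    simp
  have hΓ : ‖(Complex.Gamma (w + 3))⁻¹‖ ≤ Real.exp (Real.pi / 2 * |v|) := by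
    have := Complex.norm_inv_Gamma_le (A := A + 3) (by linarith) v
    rw [show ((A + 3 : ℝ) : ℂ) + v * Complex.I = w + 3 by rw [hw]; push_cast; ring] at this
    refine this.trans (mul_le_of_le_one_right (by positivity) (inv_le_one_of_one_le₀ ?_))
    rw [← Real.Gamma_two]
    exact Real.Gamma_strictMonoOn_Ici.monotoneOn (by simp) (by simp; linarith) (by linarith)
  rw [h3, norm_mul, norm_mul, norm_mul]
  have h0 := norm_nonneg w
  have h1 : ‖w + 1‖ ≤ |A| + |v| + 2 := (norm_add_le _ _).trans (by simp; linarith)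
  have h2 : ‖w + 2‖ ≤ |A| + |v| + 2 := (norm_add_le _ _).trans (by simp; linarith)
  calc ‖w‖ * (‖w + 1‖ * (‖w + 2‖ * ‖(Complex.Gamma (w + 3))⁻¹‖))
      ≤ (|A| + |v| + 2) * ((|A| + |v| + 2) * ((|A| + |v| + 2) * Real.exp (Real.pi / 2 * |v|))) := by
        gcongr; linarith
    _ = _ := by ring

/-- The true rate is `π lam / 2` up to a cubic polynomial. The stated rate is the midpoint of `π lam
/ 2` and `π`: half of the gap, `η`, absorbs the polynomial, and the other half remains to be beaten
by `1/sin`. -/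
theorem exists_norm_inv_Gamma_one_sub_le {lam : ℝ} (hlam : 0 < lam) (hlam2 : lam < 2) (K : ℝ) :
    ∃ C : ℝ, 0 ≤ C ∧ ∀ u : ℝ, -K ≤ u → u ≤ 1 → ∀ y : ℝ,
      ‖(Complex.Gamma (1 - lam * (u + y * Complex.I)))⁻¹‖ ≤
        C * Real.exp (Real.pi * (lam + 2) / 4 * |y|) := by
  have hη : 0 < Real.pi * (2 - lam) / 4 := by
    have : 0 < 2 - lam := by linarith
    positivity
  set η := Real.pi * (2 - lam) / 4 with hηd
  refine ⟨(2 / η) ^ 3 * 6 * Real.exp (η * (2 * |K| + 5) / 2), by positivity, fun u hu1 hu2 y => ?_⟩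
  have hA : -1 ≤ 1 - lam * u := by nlinarith
  have h := Complex.norm_inv_Gamma_le_pow hA (-(lam * y))
  rw [show ((1 - lam * u : ℝ) : ℂ) + (-(lam * y) : ℝ) * Complex.I =
    1 - lam * (u + y * Complex.I) by push_cast; ring, abs_neg, abs_mul, abs_of_pos hlam] at h
  refine h.trans ?_
  have hAb : |1 - lam * u| ≤ 2 * |K| + 3 := by
    have hu : |u| ≤ |K| + 1 := by
      rw [abs_le]; constructor <;> linarith [le_abs_self K, abs_nonneg K]
    calc |1 - lam * u| ≤ |1| + |lam * u| := abs_sub _ _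
      _ = 1 + lam * |u| := by rw [abs_one, abs_mul, abs_of_pos hlam]
      _ ≤ 1 + 2 * (|K| + 1) := by gcongr
      _ = _ := by ring
  -- Chosen so that `(2/η) X = 2|K| + 5 + 2|y|` dominates the base of the cube; then `X³ ≤ 3! e^X`.
  set X := η * (2 * |K| + 5) / 2 + η * |y| with hX
  have hX0 : 0 ≤ X := by positivity
  have hcub := Real.pow_div_factorial_le_exp X hX0 3
  have hbase : |1 - lam * u| + lam * |y| + 2 ≤ 2 / η * X := by
    have : 2 / η * X = 2 * |K| + 5 + 2 * |y| := by
      rw [hX]; field_simp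
    rw [this]
    nlinarith [abs_nonneg y]
  have h6 : ((3 : ℕ).factorial : ℝ) = 6 := by norm_num [Nat.factorial]
  rw [h6, div_le_iff₀ (by norm_num)] at hcub
  calc (|1 - lam * u| + lam * |y| + 2) ^ 3 * Real.exp (Real.pi / 2 * (lam * |y|))
      ≤ (2 / η * X) ^ 3 * Real.exp (Real.pi / 2 * (lam * |y|)) := by gcongr
    _ = (2 / η) ^ 3 * X ^ 3 * Real.exp (Real.pi / 2 * (lam * |y|)) := by ring
    _ ≤ (2 / η) ^ 3 * (Real.exp X * 6) * Real.exp (Real.pi / 2 * (lam * |y|)) := by gcongr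
    _ = _ := by
      rw [hX, Real.exp_add, show Real.pi * (lam + 2) / 4 * |y| =
        η * |y| + Real.pi / 2 * (lam * |y|) by rw [hηd]; ring, Real.exp_add]
      ring

/-! ### The Mellin–Barnes representation -/

/-- The Mellin transform of `x ↦ E_lam(-x)`. -/
noncomputable def mittagLefflerMellin (lam : ℝ) (r : ℂ) : ℂ :=
  Real.pi / Complex.sin (Real.pi * r) * (Complex.Gamma (1 - lam * r))⁻¹

theorem norm_cpow_neg_le {x : ℝ} (hx : 0 < x) {K u : ℝ} (hu : |u| ≤ K) (y : ℝ) :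
    ‖(x : ℂ) ^ (-(u + y * Complex.I))‖ ≤ Real.exp (|Real.log x| * K) := by
  rw [Complex.norm_cpow_eq_rpow_re_of_pos hx, Real.rpow_def_of_pos hx]
  refine Real.exp_le_exp.2 ?_
  have : (-(u + y * Complex.I) : ℂ).re = -u := by simp
  rw [this]
  calc Real.log x * -u ≤ |Real.log x * -u| := le_abs_self _
    _ = |Real.log x| * |u| := by rw [abs_mul, abs_neg]
    _ ≤ _ := by gcongr

theorem differentiable_inv_Gamma_mul_cpow (lam : ℝ) {x : ℝ} (hx : 0 < x) :
    Differentiable ℂ fun r : ℂ => (Complex.Gamma (1 - lam * r))⁻¹ * (x : ℂ) ^ (-r) := by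
  have hx' : (x : ℂ) ≠ 0 := by exact_mod_cast hx.ne'
  refine Differentiable.mul (Complex.differentiable_one_div_Gamma.comp (by fun_prop)) ?_
  intro r
  exact (differentiableAt_id.neg).const_cpow (Or.inl hx')

/-- With `I N` the integral on the line `Re r = 1/2 - N`, the Poisson formula on the strip between
two consecutive lines gives `I N + I (N+1) = 2 x^N / Γ(lam N + 1)`. The alternating sum telescopes
to `I 0`, and the remainder vanishes because `1/Γ` decays superexponentially. -/
theorem mittagLeffler_neg_eq_integral {lam : ℝ} (hlam : 0 < lam) (hlam2 : lam < 2) {x : ℝ}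
    (hx : 0 < x) :
    mittagLeffler lam (-(x : ℂ)) = 2⁻¹ * ∫ y : ℝ,
      (Complex.Gamma (1 - lam * ((1 / 2 : ℝ) + y * Complex.I)))⁻¹ *
        (x : ℂ) ^ (-((1 / 2 : ℝ) + y * Complex.I)) / (Real.cosh (Real.pi * y) : ℂ) := by
  set f : ℂ → ℂ := fun r => (Complex.Gamma (1 - lam * r))⁻¹ * (x : ℂ) ^ (-r) with hf
  have hfd : Differentiable ℂ f := differentiable_inv_Gamma_mul_cpow lam hx
  set I : ℕ → ℂ := fun N => ∫ y : ℝ,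
    f ((1 / 2 - N : ℝ) + y * Complex.I) / (Real.cosh (Real.pi * y) : ℂ) with hI
  have hθ0 : 0 ≤ Real.pi * (lam + 2) / 4 := by positivity
  have hθ : Real.pi * (lam + 2) / 4 < Real.pi := by nlinarith [Real.pi_pos]
  have hcosh : ∀ y : ℝ, 0 < Real.cosh (Real.pi * y) := fun y => Real.cosh_pos _
  have hbd : ∀ N : ℕ, ∃ C : ℝ, 0 ≤ C ∧ ∀ u : ℝ, |u| ≤ 1 / 2 → ∀ y : ℝ,
      ‖f ((u - N : ℝ) + y * Complex.I)‖ ≤ C * Real.exp (Real.pi * (lam + 2) / 4 * |y|) := by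
    intro N
    obtain ⟨C, hC0, hC⟩ := exists_norm_inv_Gamma_one_sub_le hlam hlam2 (N + 1)
    refine ⟨C * Real.exp (|Real.log x| * (N + 1)), by positivity, fun u hu y => ?_⟩
    have hN : (0 : ℝ) ≤ N := by positivity
    rw [abs_le] at hu
    have h1 := hC (u - N) (by linarith) (by linarith) y
    have h2 := norm_cpow_neg_le hx (K := N + 1) (u := u - N)
      (abs_le.2 ⟨by linarith, by linarith⟩) y
    rw [hf, norm_mul]
    calc _ ≤ (C * Real.exp (Real.pi * (lam + 2) / 4 * |y|)) * Real.exp (|Real.log x| * (N + 1)) := by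
          gcongr
      _ = _ := by ring
  have hint : ∀ N : ℕ, ∀ u : ℝ, |u| ≤ 1 / 2 → Integrable fun y : ℝ =>
      f ((u - N : ℝ) + y * Complex.I) / (Real.cosh (Real.pi * y) : ℂ) := by
    intro N u hu
    obtain ⟨C, hC0, hC⟩ := hbd N
    refine Continuous.integrable_of_norm_le_exp_neg (C := 2 * C)
      (δ := Real.pi - Real.pi * (lam + 2) / 4) ?_ (by linarith) fun y _ => ?_
    · refine Continuous.div (hfd.continuous.comp (by fun_prop)) ?_ fun y => by
        exact_mod_cast (hcosh y).ne'
      have := Real.continuous_cosh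
      fun_prop
    · have h := Real.exp_abs_le_cosh (Real.pi * y)
      rw [abs_mul, abs_of_pos Real.pi_pos] at h
      rw [norm_div, Complex.norm_real, Real.norm_of_nonneg (hcosh y).le]
      calc _ ≤ (C * Real.exp (Real.pi * (lam + 2) / 4 * |y|)) / (Real.exp (Real.pi * |y|) / 2) :=
            div_le_div₀ (by positivity) (hC u hu y) (by positivity) h
        _ = _ := by
          rw [sub_mul, neg_sub, Real.exp_sub]
          field_simp
  have hstep : ∀ N : ℕ, I N + I (N + 1) =
      2 * ((x : ℂ) ^ N / Complex.Gamma ((lam : ℂ) * (N : ℂ) + 1)) := by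
    intro N
    obtain ⟨C, hC0, hC⟩ := hbd N
    have key := integral_strip_div_cosh (G := fun r => f (r - N))
      (hfd.comp (by fun_prop)) hθ0 hθ fun u hu y => by
        have := hC u (abs_le.2 hu) y
        rwa [show ((u - N : ℝ) : ℂ) + y * Complex.I = u + y * Complex.I - N by push_cast; ring]
          at this
    have e0 : f (0 - N) = (x : ℂ) ^ N / Complex.Gamma ((lam : ℂ) * (N : ℂ) + 1) := by
      simp only [hf]
      rw [zero_sub, neg_neg, Complex.cpow_natCast, div_eq_mul_inv, mul_comm]
      ring_nf
    rw [e0] at key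
    rw [← key, hI]
    have hm := hint N (1 / 2) (by norm_num [abs_of_pos])
    have hp := hint N (-(1 / 2)) (by norm_num [abs_of_pos])
    have hp' : (fun y : ℝ => f ((1 / 2 - (N + 1 : ℕ) : ℝ) + y * Complex.I) /
        (Real.cosh (Real.pi * y) : ℂ)) = fun y : ℝ => f ((-(1 / 2) - N : ℝ) + y * Complex.I) /
        (Real.cosh (Real.pi * y) : ℂ) := by
      funext y
      congr 4
      push_cast
      ring
    simp only [hp']
    rw [← integral_add hm hp]
    congr 1
    funext y
    rw [add_div]
    congr 4 <;> push_cast <;> ring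
  have hsum : ∀ N : ℕ, I 0 = 2 * ∑ n ∈ Finset.range N,
      (-(x : ℂ)) ^ n / Complex.Gamma ((lam : ℂ) * (n : ℂ) + 1) + (-1) ^ N * I N := by
    intro N
    induction N with
    | zero => simp
    | succ N ih =>
      rw [ih, Finset.sum_range_succ, mul_add, neg_pow (x : ℂ) N, pow_succ]
      linear_combination (-1) ^ N * hstep N
  have hdec : Tendsto (fun N => (-1) ^ N * I N) atTop (𝓝 0) := by
    -- As for the series, this `T` turns the Gamma bound into `(2x)^(-(N - 1/2))`, which leaves
    -- `(1/2)^(N - 1/2)` against `x^(N - 1/2)`.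
    have hT : 0 < (2 * x) ^ lam⁻¹ := by positivity
    set J : ℝ := ∫ y : ℝ, 2 * Real.exp (-((Real.pi - Real.pi / 2 * lam) * |y|)) with hJ
    have hδ : 0 < Real.pi - Real.pi / 2 * lam := by nlinarith [Real.pi_pos]
    have hle : ∀ N : ℕ, 1 ≤ N → ‖(-1) ^ N * I N‖ ≤
        Real.exp ((2 * x) ^ lam⁻¹) * J * (1 / 2 : ℝ) ^ ((N : ℝ) - 1 / 2) := by
      intro N hN
      have hN' : (1 : ℝ) ≤ N := by exact_mod_cast hN
      rw [norm_mul, norm_pow, norm_neg, norm_one, one_pow, one_mul]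
      have hs : 0 ≤ lam * (N - 1 / 2) := mul_nonneg hlam.le (by linarith)
      have hG := Real.inv_Gamma_add_one_le hT hs
      have hpow : ((2 * x) ^ lam⁻¹) ^ (lam * ((N : ℝ) - 1 / 2)) = (2 * x) ^ ((N : ℝ) - 1 / 2) := by
        rw [← Real.rpow_mul (by positivity), ← mul_assoc, inv_mul_cancel₀ hlam.ne', one_mul]
      rw [hpow] at hG
      have hpt : ∀ y : ℝ, ‖f ((1 / 2 - N : ℝ) + y * Complex.I) / (Real.cosh (Real.pi * y) : ℂ)‖ ≤
          (Real.exp ((2 * x) ^ lam⁻¹) * (1 / 2 : ℝ) ^ ((N : ℝ) - 1 / 2)) *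
            (2 * Real.exp (-((Real.pi - Real.pi / 2 * lam) * |y|))) := by
        intro y
        have hA := Complex.norm_inv_Gamma_le (A := lam * (N - 1 / 2) + 1) (by linarith) (-(lam * y))
        rw [show ((lam * (N - 1 / 2) + 1 : ℝ) : ℂ) + (-(lam * y) : ℝ) * Complex.I =
          1 - lam * ((1 / 2 - N : ℝ) + y * Complex.I) by push_cast; ring, abs_neg, abs_mul,
          abs_of_pos hlam] at hA
        have hc := Real.exp_abs_le_cosh (Real.pi * y)
        rw [abs_mul, abs_of_pos Real.pi_pos] at hc
        have hxn : ‖(x : ℂ) ^ (-((1 / 2 - N : ℝ) + y * Complex.I))‖ = x ^ ((N : ℝ) - 1 / 2) := by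
          rw [Complex.norm_cpow_eq_rpow_re_of_pos hx]
          congr 1
          simp
        rw [norm_div, Complex.norm_real, Real.norm_of_nonneg (hcosh y).le, hf, norm_mul, hxn]
        calc _ ≤ (Real.exp (Real.pi / 2 * (lam * |y|)) *
              (Real.exp ((2 * x) ^ lam⁻¹) * ((2 * x) ^ ((N : ℝ) - 1 / 2))⁻¹) *
                x ^ ((N : ℝ) - 1 / 2)) / (Real.exp (Real.pi * |y|) / 2) := by
              refine div_le_div₀ (by positivity) ?_ (by positivity) hc
              gcongr
              exact hA.trans (by gcongr)
          _ = _ := by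
              rw [Real.mul_rpow (z := (N : ℝ) - 1 / 2) (by norm_num) hx.le, one_div, Real.inv_rpow (by norm_num),
                sub_mul, neg_sub, Real.exp_sub, show Real.pi / 2 * lam * |y| =
                  Real.pi / 2 * (lam * |y|) by ring]
              have : 0 < x ^ ((N : ℝ) - 1 / 2) := by positivity
              field_simp
      calc ‖I N‖ ≤ ∫ y : ℝ, (Real.exp ((2 * x) ^ lam⁻¹) * (1 / 2 : ℝ) ^ ((N : ℝ) - 1 / 2)) *
            (2 * Real.exp (-((Real.pi - Real.pi / 2 * lam) * |y|))) :=
            norm_integral_le_of_norm_le (((integrable_exp_neg_mul_abs hδ).const_mul 2).const_mul _)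
              (Eventually.of_forall hpt)
        _ = _ := by rw [integral_const_mul, ← hJ]; ring
    refine squeeze_zero_norm' ((eventually_ge_atTop 1).mono hle) ?_
    have h0 : Tendsto (fun N : ℕ => (1 / 2 : ℝ) ^ N) atTop (𝓝 0) :=
      tendsto_pow_atTop_nhds_zero_of_lt_one (by norm_num) (by norm_num)
    have := h0.const_mul (Real.exp ((2 * x) ^ lam⁻¹) * J * (1 / 2 : ℝ) ^ (-(1 / 2) : ℝ))
    rw [mul_zero] at this
    refine this.congr fun N => ?_
    rw [sub_eq_add_neg, Real.rpow_add (by norm_num), Real.rpow_natCast]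
    ring
  have hlim := ((mittagLeffler_summable hlam (-(x : ℂ))).hasSum.tendsto_sum_nat.const_mul
    (2 : ℂ)).add hdec
  have := tendsto_nhds_unique hlim (tendsto_const_nhds.congr fun N => hsum N)
  rw [add_zero] at this
  change 2 * mittagLeffler lam (-(x : ℂ)) = I 0 at this
  have hI0 : I 0 = ∫ y : ℝ, (Complex.Gamma (1 - lam * ((1 / 2 : ℝ) + y * Complex.I)))⁻¹ *
        (x : ℂ) ^ (-((1 / 2 : ℝ) + y * Complex.I)) / (Real.cosh (Real.pi * y) : ℂ) := by
    simp [hI, hf]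
  rw [← hI0, ← this]
  ring

/-- The restriction `1 ≤ |y|` keeps away from the zeros of the sine at 0 and 1, where `|sin|` is
still bounded below by `|sinh(πy)|`. -/
theorem exists_norm_mittagLefflerMellin_le {lam : ℝ} (hlam : 0 < lam) (hlam2 : lam < 2) :
    ∃ C : ℝ, 0 ≤ C ∧ ∀ u : ℝ, 0 ≤ u → u ≤ 1 → ∀ y : ℝ, 1 ≤ |y| →
      ‖mittagLefflerMellin lam (u + y * Complex.I)‖ ≤
        C * Real.exp (-(Real.pi * (2 - lam) / 4 * |y|)) := by
  obtain ⟨C, hC0, hC⟩ := exists_norm_inv_Gamma_one_sub_le hlam hlam2 0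
  refine ⟨Real.pi * 4 * C, by positivity, fun u hu0 hu1 y hy => ?_⟩
  have h1 := hC u (by simpa using hu0) hu1 y
  have hπy : 1 ≤ |Real.pi * y| := by
    rw [abs_mul, abs_of_pos Real.pi_pos]
    nlinarith [Real.pi_gt_three]
  have hs := (Real.exp_abs_le_abs_sinh hπy).trans (Complex.abs_sinh_le_norm_sin (Real.pi * u) _)
  rw [abs_mul, abs_of_pos Real.pi_pos, show ((Real.pi * u : ℝ) : ℂ) + (Real.pi * y : ℝ) * Complex.I
    = Real.pi * (u + y * Complex.I) by push_cast; ring] at hs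
  rw [mittagLefflerMellin, norm_mul, norm_div, Complex.norm_real, Real.norm_of_nonneg Real.pi_pos.le]
  calc _ ≤ Real.pi / (Real.exp (Real.pi * |y|) / 4) *
        (C * Real.exp (Real.pi * (lam + 2) / 4 * |y|)) := by gcongr
    _ = _ := by
      rw [show -(Real.pi * (2 - lam) / 4 * |y|) = Real.pi * (lam + 2) / 4 * |y| - Real.pi * |y| by
        ring, Real.exp_sub]
      field_simp

theorem Complex.sin_pi_mul_ne_zero {r : ℂ} (h0 : 0 < r.re) (h1 : r.re < 1) :
    Complex.sin (Real.pi * r) ≠ 0 := by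
  intro hz
  obtain ⟨k, hk⟩ := Complex.sin_eq_zero_iff.1 hz
  have hpi : (Real.pi : ℂ) ≠ 0 := by exact_mod_cast Real.pi_ne_zero
  have hrk : r = k := mul_left_cancel₀ hpi (by rw [hk]; ring)
  rw [hrk, Complex.intCast_re] at h0 h1
  have h2 : (0 : ℤ) < k := by exact_mod_cast h0
  have h3 : k < (1 : ℤ) := by exact_mod_cast h1
  omega

theorem differentiableAt_mittagLefflerMellin (lam : ℝ) {r : ℂ} (h0 : 0 < r.re) (h1 : r.re < 1) :
    DifferentiableAt ℂ (mittagLefflerMellin lam) r := by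
  have h2 : Differentiable ℂ fun r : ℂ => (Complex.Gamma (1 - lam * r))⁻¹ :=
    Complex.differentiable_one_div_Gamma.comp (by fun_prop)
  refine DifferentiableAt.mul (DifferentiableAt.div (by fun_prop) (by fun_prop) ?_) (h2 r)
  exact Complex.sin_pi_mul_ne_zero h0 h1

theorem integrable_mittagLefflerMellin {lam : ℝ} (hlam : 0 < lam) (hlam2 : lam < 2) {c : ℝ}
    (h0 : 0 < c) (h1 : c < 1) :
    Continuous (fun y : ℝ => mittagLefflerMellin lam (c + y * Complex.I)) ∧
    Integrable fun y : ℝ => mittagLefflerMellin lam (c + y * Complex.I) := by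
  obtain ⟨C, hC0, hC⟩ := exists_norm_mittagLefflerMellin_le hlam hlam2
  have hcont : Continuous (fun y : ℝ => mittagLefflerMellin lam (c + y * Complex.I)) := by
    refine continuous_iff_continuousAt.2 fun y => ?_
    refine ContinuousAt.comp (f := fun y : ℝ => (c + y * Complex.I : ℂ))
      (differentiableAt_mittagLefflerMellin lam (by simpa) (by simpa)).continuousAt ?_
    fun_prop
  exact ⟨hcont, hcont.integrable_of_norm_le_exp_neg
    (by have := Real.pi_pos; have : 0 < 2 - lam := by linarith
        positivity) (hC c h0.le h1.le)⟩

theorem integral_mittagLefflerMellin_mul_cpow_eq {lam : ℝ} (hlam : 0 < lam) (hlam2 : lam < 2)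
    {x : ℝ} (hx : 0 < x) {a b : ℝ} (ha : 0 < a) (hab : a ≤ b) (hb : b < 1) :
    ∫ y : ℝ, mittagLefflerMellin lam (a + y * Complex.I) * (x : ℂ) ^ (-(a + y * Complex.I)) =
    ∫ y : ℝ, mittagLefflerMellin lam (b + y * Complex.I) * (x : ℂ) ^ (-(b + y * Complex.I)) := by
  obtain ⟨C, hC0, hC⟩ := exists_norm_mittagLefflerMellin_le hlam hlam2
  have hδ : 0 < Real.pi * (2 - lam) / 4 := by
    have := Real.pi_pos
    have : 0 < 2 - lam := by linarith
    positivity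
  refine integral_vertical_eq_of_norm_le_exp_neg
    (H := fun r => mittagLefflerMellin lam r * (x : ℂ) ^ (-r)) hab hδ (fun r hr => ?_)
    (C := C * Real.exp (|Real.log x| * 1)) fun u hu y hy => ?_
  · refine DifferentiableAt.differentiableWithinAt ?_
    refine (differentiableAt_mittagLefflerMellin lam (ha.trans_le hr.1) (hr.2.trans_lt hb)).mul ?_
    exact (differentiableAt_id.neg).const_cpow (Or.inl (by exact_mod_cast hx.ne'))
  · rw [norm_mul]
    have h1 := hC u (ha.le.trans hu.1) (hu.2.trans hb.le) y hy
    have h2 := norm_cpow_neg_le hx (K := 1) (u := u)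
      (abs_le.2 ⟨by linarith [hu.1], by linarith [hu.2]⟩) y
    calc _ ≤ (C * Real.exp (-(Real.pi * (2 - lam) / 4 * |y|))) * Real.exp (|Real.log x| * 1) := by
          gcongr
      _ = _ := by ring

/-- The Mellin–Barnes representation of the Mittag-Leffler function on the negative axis. -/
theorem mittagLeffler_neg_eq_mellinInv {lam : ℝ} (hlam : 0 < lam) (hlam2 : lam < 2)
    {x : ℝ} (hx : 0 < x) {c : ℝ} (h0 : 0 < c) (h1 : c < 1) :
    mittagLeffler lam (-(x : ℂ)) = mellinInv c (mittagLefflerMellin lam) x := by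
  have hhalf : ∫ y : ℝ, mittagLefflerMellin lam (c + y * Complex.I) *
      (x : ℂ) ^ (-(c + y * Complex.I)) = ∫ y : ℝ, mittagLefflerMellin lam
        ((1 / 2 : ℝ) + y * Complex.I) * (x : ℂ) ^ (-((1 / 2 : ℝ) + y * Complex.I)) := by
    rcases le_total c (1 / 2) with h | h
    · exact integral_mittagLefflerMellin_mul_cpow_eq hlam hlam2 hx h0 h (by norm_num)
    · exact (integral_mittagLefflerMellin_mul_cpow_eq hlam hlam2 hx (by norm_num) h h1).symm
  have hpi : (Real.pi : ℂ) ≠ 0 := by exact_mod_cast Real.pi_ne_zero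
  have hsin : ∀ y : ℝ, Complex.sin (Real.pi * ((1 / 2 : ℝ) + y * Complex.I)) =
      (Real.cosh (Real.pi * y) : ℂ) := fun y => by
    rw [show (Real.pi : ℂ) * ((1 / 2 : ℝ) + y * Complex.I) =
      (Real.pi / 2 : ℝ) + (Real.pi * y : ℝ) * Complex.I by push_cast; ring,
      Complex.sin_add_mul_I, ← Complex.ofReal_sin, ← Complex.ofReal_cos, Real.sin_pi_div_two,
      Real.cos_pi_div_two]
    simp
  have hcomm : mellinInv c (mittagLefflerMellin lam) x = (1 / (2 * Real.pi) : ℝ) • ∫ y : ℝ,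
      mittagLefflerMellin lam (c + y * Complex.I) * (x : ℂ) ^ (-(c + y * Complex.I)) := by
    rw [mellinInv]
    simp only [smul_eq_mul, mul_comm]
  rw [mittagLeffler_neg_eq_integral hlam hlam2 hx, hcomm, hhalf]
  have : ∀ y : ℝ, mittagLefflerMellin lam ((1 / 2 : ℝ) + y * Complex.I) *
      (x : ℂ) ^ (-((1 / 2 : ℝ) + y * Complex.I)) = Real.pi *
        ((Complex.Gamma (1 - lam * ((1 / 2 : ℝ) + y * Complex.I)))⁻¹ *
        (x : ℂ) ^ (-((1 / 2 : ℝ) + y * Complex.I)) / (Real.cosh (Real.pi * y) : ℂ)) := fun y => by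
    rw [mittagLefflerMellin, hsin]
    ring
  simp only [this]
  rw [integral_const_mul, Complex.real_smul, ← mul_assoc]
  congr 1
  push_cast
  field_simp

/-! ### Decay on the negative axis and the Mellin transform -/

/-- On the line `Re r = c` the factor `x^(-r)` has constant modulus `x^(-c)`, and what remains is
integrable. -/
theorem exists_norm_mittagLeffler_neg_le_rpow {lam : ℝ} (hlam : 0 < lam) (hlam2 : lam < 2)
    {c : ℝ} (h0 : 0 < c) (h1 : c < 1) :
    ∃ K : ℝ, 0 ≤ K ∧ ∀ x : ℝ, 0 < x → ‖mittagLeffler lam (-(x : ℂ))‖ ≤ K * x ^ (-c) := by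
  refine ⟨|1 / (2 * Real.pi)| * ∫ y : ℝ, ‖mittagLefflerMellin lam (c + y * Complex.I)‖,
    by positivity, fun x hx => ?_⟩
  rw [mittagLeffler_neg_eq_mellinInv hlam hlam2 hx h0 h1, mellinInv, norm_smul, Real.norm_eq_abs,
    mul_assoc]
  refine mul_le_mul_of_nonneg_left ?_ (abs_nonneg _)
  refine (norm_integral_le_integral_norm _).trans (le_of_eq ?_)
  rw [← integral_mul_const]
  congr 1; funext y
  rw [norm_smul, Complex.norm_cpow_eq_rpow_re_of_pos hx, mul_comm]
  simp

theorem exists_norm_mittagLeffler_neg_le {lam : ℝ} (hlam : 0 < lam) (hlam2 : lam ≤ 2) :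
    ∃ K : ℝ, 0 ≤ K ∧ ∀ x : ℝ, 0 ≤ x → ‖mittagLeffler lam (-(x : ℂ))‖ ≤ K := by
  rcases hlam2.eq_or_lt with rfl | hlt
  · refine ⟨1, zero_le_one, fun x hx => ?_⟩
    have h : (x : ℂ) = (√x : ℂ) ^ 2 := by exact_mod_cast (Real.sq_sqrt hx).symm
    have h2 := mittagLeffler_two_neg_sq (√x : ℂ)
    rw [h]
    rw [h2, ← Complex.ofReal_cos, Complex.norm_real]
    exact Real.abs_cos_le_one _
  · obtain ⟨K, hK0, hK⟩ := exists_norm_mittagLeffler_neg_le_rpow hlam hlt (c := 1 / 2)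
      (by norm_num) (by norm_num)
    have hcont : Continuous fun x : ℝ => mittagLeffler lam (-(x : ℂ)) :=
      (mittagLeffler_continuous hlam).comp (by fun_prop)
    obtain ⟨M, hM⟩ := isCompact_Icc.exists_bound_of_continuousOn (s := Icc (0 : ℝ) 1)
      hcont.continuousOn
    refine ⟨max K M, hK0.trans (le_max_left _ _), fun x hx => ?_⟩
    rcases le_total x 1 with h | h
    · exact (hM x ⟨hx, h⟩).trans (le_max_right _ _)
    · refine ((hK x (by linarith)).trans ?_).trans (le_max_left _ _)
      exact mul_le_of_le_one_right hK0 (Real.rpow_le_one_of_one_le_of_nonpos h (by norm_num))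

theorem hasMellin_mittagLeffler_neg {lam : ℝ} (hlam : 0 < lam) (hlam2 : lam < 2) {r : ℂ}
    (h0 : 0 < r.re) (h1 : r.re < 1) :
    HasMellin (fun x : ℝ => mittagLeffler lam (-(x : ℂ))) r (mittagLefflerMellin lam r) := by
  obtain ⟨K, hK0, hK⟩ := exists_norm_mittagLeffler_neg_le hlam hlam2.le
  -- An exponent strictly between `Re r` and 1, so that `x^(r-1) E(-x)` is integrable at infinity.
  obtain ⟨K', hK0', hK'⟩ := exists_norm_mittagLeffler_neg_le_rpow hlam hlam2 (c := (1 + r.re) / 2)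
    (by linarith) (by linarith)
  have hcont : Continuous fun x : ℝ => mittagLeffler lam (-(x : ℂ)) :=
    (mittagLeffler_continuous hlam).comp (by fun_prop)
  constructor
  · refine mellinConvergent_of_isBigO_rpow (a := (1 + r.re) / 2) (b := 0)
      (hcont.continuousOn.locallyIntegrableOn measurableSet_Ioi) ?_ (by linarith) ?_ h0
    · refine Asymptotics.IsBigO.of_bound K' ((eventually_gt_atTop 0).mono fun x hx => ?_)
      rw [Real.norm_of_nonneg (by positivity)]
      exact hK' x hx
    · refine Asymptotics.IsBigO.of_bound K ?_
      filter_upwards [self_mem_nhdsWithin] with x hx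
      simpa using hK x (le_of_lt hx)
  · set c := r.re with hc
    set φ : ℝ → ℂ := fun y => mittagLefflerMellin lam (c + 2 * Real.pi * y * Complex.I) with hφ
    have hφe : φ = fun y => (fun y : ℝ => mittagLefflerMellin lam (c + y * Complex.I))
        (2 * Real.pi * y) := by
      funext y; simp [hφ]
    obtain ⟨hF1, hF2⟩ := integrable_mittagLefflerMellin hlam hlam2 h0 h1
    have hφc : Continuous φ := by
      rw [hφe]; exact hF1.comp (by fun_prop)
    have hφi : Integrable φ := by
      rw [hφe]; exact hF2.comp_mul_left' (by positivity)
    -- Under `x = e^(-u)` the Mellin–Barnes formula says that `e^(-cu) E(-e^(-u))` is the inverse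
    -- Fourier transform of `φ`. Once this function is known to be integrable, Fourier inversion
    -- recovers `φ`, hence the Mellin transform.
    have hinv : (fun u : ℝ => Real.exp (-c * u) • mittagLeffler lam (-(Real.exp (-u) : ℂ))) =
        FourierTransformInv.fourierInv φ := by
      funext u
      have hx := Real.exp_pos (-u)
      have := mittagLeffler_neg_eq_mellinInv hlam hlam2 hx h0 h1
      rw [mellinInv_eq_fourierInv _ _ hx, Real.log_exp, neg_neg] at this
      rw [Complex.ofReal_exp] at this
      rw [Complex.ofReal_exp, this, smul_eq_mul, Complex.real_smul, ← mul_assoc, ← Complex.ofReal_exp,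
        ← Complex.ofReal_neg, ← Complex.ofReal_cpow hx.le, ← Complex.ofReal_mul, ← Real.exp_mul,
        ← Real.exp_add, show -c * u + -u * -c = 0 by ring]
      simp [hφ]
    have hinvI : Integrable (FourierTransformInv.fourierInv φ) := by
      rw [← hinv]
      -- Boundedness of `E` gives decay at rate `c` as `u → ∞`; the bound `x^(-(1+c)/2)` leaves rate
      -- `(1-c)/2` as `u → -∞`.
      have hδ : 0 < min c ((1 - c) / 2) := lt_min h0 (by linarith)
      refine ((integrable_exp_neg_mul_abs hδ).const_mul (max K K')).mono' ?_
        (Eventually.of_forall fun u => ?_)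
      · have : Continuous fun u : ℝ => Real.exp (-c * u) •
            mittagLeffler lam (-(Real.exp (-u) : ℂ)) := by
          have hexp : Continuous fun u : ℝ => Real.exp (-u) := by fun_prop
          have hexp' : Continuous fun u : ℝ => Real.exp (-c * u) := by fun_prop
          exact hexp'.smul (hcont.comp hexp)
        exact this.aestronglyMeasurable
      · rw [norm_smul, Real.norm_of_nonneg (Real.exp_pos _).le]
        rcases le_total 0 u with hu | hu
        · rw [abs_of_nonneg hu, mul_comm]
          have := hK _ (Real.exp_pos (-u)).le
          refine mul_le_mul (this.trans (le_max_left _ _)) (Real.exp_le_exp.2 ?_)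
            (Real.exp_pos _).le (hK0.trans (le_max_left _ _))
          have := mul_le_mul_of_nonneg_right (min_le_left c ((1 - c) / 2)) hu
          linarith
        · rw [abs_of_nonpos hu]
          have := hK' _ (Real.exp_pos (-u))
          rw [← Real.exp_mul] at this
          calc _ ≤ Real.exp (-c * u) * (K' * Real.exp (-u * -((1 + c) / 2))) := by gcongr
            _ = K' * Real.exp ((1 - c) / 2 * u) := by
              rw [mul_left_comm, ← Real.exp_add]; ring_nf
            _ ≤ _ := by
              refine mul_le_mul (le_max_right _ _) (Real.exp_le_exp.2 ?_)
                (Real.exp_pos _).le (hK0.trans (le_max_left _ _))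
              have := mul_le_mul_of_nonpos_right (min_le_right c ((1 - c) / 2)) hu
              linarith
    have hFI : Integrable (FourierTransform.fourier φ) := by
      have : FourierTransform.fourier φ = fun u => FourierTransformInv.fourierInv φ (-u) := by
        funext u
        rw [Real.fourierInv_eq_fourier_neg, neg_neg]
      rw [this]
      exact hinvI.comp_neg
    rw [mellin_eq_fourier]
    rw [← hc, hinv, hφc.fourier_fourierInv_eq hφi hFI]
    simp only [hφ]
    congr 1
    have hpi : (Real.pi : ℂ) ≠ 0 := by exact_mod_cast Real.pi_ne_zero
    push_cast
    rw [mul_div_cancel₀ _ (by simp [hpi])]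
    exact Complex.re_add_im r

/-! ### Beta integrals and Euler's integral for `Φ` -/

/-- Termwise integration of the exponential series against a beta type weight. -/
theorem hasSum_integral_beta_weight {a b z : ℂ} {k : ℝ → ℂ}
    (hk : IntervalIntegrable (fun t : ℝ => (t : ℂ) ^ (a - 1) * (1 - (t : ℂ)) ^ (b - 1) * k t)
      volume 0 1) :
    (∀ n : ℕ, IntervalIntegrable
      (fun t : ℝ => (t : ℂ) ^ (a + n - 1) * (1 - (t : ℂ)) ^ (b - 1) * k t) volume 0 1) ∧
    HasSum (fun n : ℕ => (∫ t in (0 : ℝ)..1,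
        (t : ℂ) ^ (a + n - 1) * (1 - (t : ℂ)) ^ (b - 1) * k t) * (z ^ n / (n.factorial : ℂ)))
      (∫ t in (0 : ℝ)..1, (t : ℂ) ^ (a - 1) * (1 - (t : ℂ)) ^ (b - 1) * k t *
        Complex.exp (z * t)) := by
  set v : ℝ → ℂ := fun t => (t : ℂ) ^ (a - 1) * (1 - (t : ℂ)) ^ (b - 1) * k t with hv
  rw [intervalIntegrable_iff_integrableOn_Ioc_of_le zero_le_one] at hk
  have hshift : ∀ n : ℕ, ∀ t ∈ Ioc (0 : ℝ) 1,
      v t * (t : ℂ) ^ n = (t : ℂ) ^ (a + n - 1) * (1 - (t : ℂ)) ^ (b - 1) * k t := by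
    intro n t ht
    have ht0 : (t : ℂ) ≠ 0 := by exact_mod_cast ht.1.ne'
    rw [show a + n - 1 = (a - 1) + n by ring, Complex.cpow_add _ _ ht0, Complex.cpow_natCast]
    ring
  have hle : ∀ n : ℕ, ∀ t ∈ Ioc (0 : ℝ) 1, ‖v t * (t : ℂ) ^ n‖ ≤ ‖v t‖ := by
    intro n t ht
    rw [norm_mul, norm_pow, Complex.norm_real, Real.norm_of_nonneg ht.1.le]
    exact mul_le_of_le_one_right (norm_nonneg _) (pow_le_one₀ ht.1.le ht.2)
  have hint : ∀ n : ℕ, IntegrableOn (fun t : ℝ => v t * (t : ℂ) ^ n) (Ioc 0 1) := by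
    intro n
    refine Integrable.mono' hk.norm (hk.aestronglyMeasurable.mul ?_) ?_
    · exact Continuous.aestronglyMeasurable (by fun_prop)
    · exact (ae_restrict_iff' measurableSet_Ioc).2 (Eventually.of_forall (hle n))
  refine ⟨fun n => ?_, ?_⟩
  · rw [intervalIntegrable_iff_integrableOn_Ioc_of_le zero_le_one]
    exact (hint n).congr_fun (hshift n) measurableSet_Ioc
  · have hsum := hasSum_integral_of_summable_integral_norm
      (F := fun (n : ℕ) (t : ℝ) => v t * (t : ℂ) ^ n * (z ^ n / (n.factorial : ℂ)))
      (μ := volume.restrict (Ioc 0 1)) (fun n => (hint n).mul_const _) ?_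
    · have e1 : ∀ n : ℕ, (∫ t in (0 : ℝ)..1,
          (t : ℂ) ^ (a + n - 1) * (1 - (t : ℂ)) ^ (b - 1) * k t) * (z ^ n / (n.factorial : ℂ)) =
          ∫ t in Ioc (0 : ℝ) 1, v t * (t : ℂ) ^ n * (z ^ n / (n.factorial : ℂ)) := fun n => by
        rw [integral_mul_const, intervalIntegral.integral_of_le zero_le_one]
        congr 1
        exact (setIntegral_congr_fun measurableSet_Ioc (hshift n)).symm
      simp only [e1]
      suffices heq : ∫ t in (0 : ℝ)..1, v t * Complex.exp (z * t) = ∫ t in Ioc (0 : ℝ) 1,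
          ∑' n : ℕ, v t * (t : ℂ) ^ n * (z ^ n / (n.factorial : ℂ)) from heq ▸ hsum
      rw [intervalIntegral.integral_of_le zero_le_one]
      congr 1; funext t
      rw [Complex.exp_eq_exp_ℂ, NormedSpace.exp_eq_tsum_div, ← tsum_mul_left]
      congr 1; funext n
      rw [mul_pow]; ring
    · refine Summable.of_nonneg_of_le (fun n => by positivity) (fun n => ?_)
        ((Real.summable_pow_div_factorial ‖z‖).mul_left (∫ t in Ioc (0 : ℝ) 1, ‖v t‖))
      rw [← integral_mul_const]
      refine setIntegral_mono_on ((hint n).mul_const _).norm (hk.norm.mul_const _)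
        measurableSet_Ioc fun t ht => ?_
      rw [norm_mul, norm_div, norm_pow z, Complex.norm_natCast]
      exact mul_le_mul_of_nonneg_right (hle n t ht) (by positivity)

/-- Each unit step multiplies the beta integral by `(a + n) / (a + b + n)`, by the functional
equation of `Γ`. This turns the moments of the beta weight into the coefficients of `Φ`. -/
theorem Complex.betaIntegral_add_nat {a b : ℂ} (ha : 0 < a.re) (hb : 0 < b.re) (n : ℕ) :
    Complex.betaIntegral (a + n) b = Complex.betaIntegral a b *
      ((ascPochhammer ℂ n).eval a / (ascPochhammer ℂ n).eval (a + b)) := by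
  induction n with
  | zero => simp
  | succ n ih =>
    have han : 0 < (a + n).re := by
      simp only [Complex.add_re, Complex.natCast_re]; positivity
    have hanb : 0 < (a + n + b).re := by
      rw [Complex.add_re]; positivity
    have hne : a + n + b ≠ 0 := fun h => by rw [h] at hanb; simp at hanb
    have hne0 : a + n ≠ 0 := fun h => by rw [h] at han; simp at han
    have h1 := Complex.Gamma_mul_Gamma_eq_betaIntegral han hb
    have h2 := Complex.Gamma_mul_Gamma_eq_betaIntegral (s := a + n + 1)
      (by rw [Complex.add_re]; simp only [Complex.one_re]; linarith) hb
    rw [Complex.Gamma_add_one _ hne0, show a + n + 1 + b = a + n + b + 1 by ring,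
      Complex.Gamma_add_one _ hne] at h2
    have hG := Complex.Gamma_ne_zero_of_re_pos hanb
    have h3 : (a + n + b) * Complex.betaIntegral (a + n + 1) b =
        (a + n) * Complex.betaIntegral (a + n) b := by
      refine mul_left_cancel₀ hG ?_
      linear_combination -h2 + (a + n) * h1
    rw [ih] at h3
    rw [ascPochhammer_succ_eval, ascPochhammer_succ_eval]
    push_cast
    rw [← add_assoc, (eq_div_iff hne).2 ((mul_comm _ _).trans h3)]
    rw [show a + b + n = a + n + b by ring]
    field_simp

theorem betaIntegral_mul_confluent {a b : ℂ} (ha : 0 < a.re) (hb : 0 < b.re) (z : ℂ) :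
    Complex.betaIntegral a b * confluent a (a + b) z =
      ∫ t in (0 : ℝ)..1, (t : ℂ) ^ (a - 1) * (1 - (t : ℂ)) ^ (b - 1) * Complex.exp (z * t) := by
  have h := (hasSum_integral_beta_weight (a := a) (b := b) (z := z) (k := fun _ => 1)
    (by simpa using Complex.betaIntegral_convergent ha hb)).2
  simp only [mul_one] at h
  rw [← h.tsum_eq, confluent, ← tsum_mul_left]
  congr 1; funext n
  change _ = Complex.betaIntegral (a + n) b * _
  rw [Complex.betaIntegral_add_nat ha hb]
  ring

/-! ### Fubini and dilations of Mellin transforms -/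

/-- Fubini's theorem for a superposition of products of two kernels. -/
theorem integrable_integral_mul_kernels {α β : Type*} [MeasurableSpace α] [MeasurableSpace β]
    {μ : Measure α} {ν : Measure β} [SFinite μ] [SFinite ν] {w : α → ℂ} {k₁ k₂ : α → β → ℂ}
    {A₁ A₂ : ℝ} (hw : Integrable w μ) (hm₁ : Measurable (Function.uncurry k₁))
    (hm₂ : Measurable (Function.uncurry k₂))
    (h₁ : ∀ᵐ t ∂μ, Integrable (k₁ t) ν ∧ ∫ x, ‖k₁ t x‖ ∂ν ≤ A₁)
    (h₂ : ∀ᵐ t ∂μ, Integrable (k₂ t) ν ∧ ∫ x, ‖k₂ t x‖ ∂ν ≤ A₂) :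
    Integrable (fun x : β × β => ∫ t, w t * (k₁ t x.1 * k₂ t x.2) ∂μ) (ν.prod ν) ∧
    ∫ x : β × β, ∫ t, w t * (k₁ t x.1 * k₂ t x.2) ∂μ ∂(ν.prod ν) =
      ∫ t, w t * ((∫ x, k₁ t x ∂ν) * ∫ x, k₂ t x ∂ν) ∂μ := by
  set F : α × (β × β) → ℂ := fun x => w x.1 * (k₁ x.1 x.2.1 * k₂ x.1 x.2.2) with hF
  have hFm : AEStronglyMeasurable F (μ.prod (ν.prod ν)) := by
    refine hw.aestronglyMeasurable.comp_fst.mul (Measurable.aestronglyMeasurable ?_)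
    exact (hm₁.comp (measurable_fst.prodMk (measurable_fst.comp measurable_snd))).mul
      (hm₂.comp (measurable_fst.prodMk (measurable_snd.comp measurable_snd)))
  have hFi : Integrable F (μ.prod (ν.prod ν)) := by
    rw [integrable_prod_iff hFm]
    refine ⟨?_, ?_⟩
    · filter_upwards [h₁, h₂] with t ht₁ ht₂
      exact (ht₁.1.mul_prod ht₂.1).const_mul (w t)
    · refine Integrable.mono' (hw.norm.mul_const (A₁ * A₂)) hFm.norm.integral_prod_right' ?_
      filter_upwards [h₁, h₂] with t ht₁ ht₂
      rw [Real.norm_of_nonneg (integral_nonneg fun _ => norm_nonneg _)]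
      simp only [hF, norm_mul]
      rw [integral_const_mul, integral_prod_mul (fun x => ‖k₁ t x‖) (fun x => ‖k₂ t x‖)]
      have : 0 ≤ ∫ x, ‖k₁ t x‖ ∂ν := integral_nonneg fun _ => norm_nonneg _
      have : 0 ≤ ∫ x, ‖k₂ t x‖ ∂ν := integral_nonneg fun _ => norm_nonneg _
      gcongr
      · linarith
      · exact ht₁.2
      · exact ht₂.2
  refine ⟨hFi.integral_prod_right, ?_⟩
  rw [← integral_prod_symm F hFi, integral_prod F hFi]
  congr 1; funext t
  simp only [hF]
  rw [integral_const_mul, integral_prod_mul]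

theorem restrict_Ioi_prod_Ioi :
    (volume.restrict (Ioi (0 : ℝ) ×ˢ Ioi (0 : ℝ)) : Measure (ℝ × ℝ)) =
      (volume.restrict (Ioi 0)).prod (volume.restrict (Ioi 0)) := by
  rw [Measure.prod_restrict, ← Measure.volume_eq_prod]

theorem doubleMellin_eq_integral {f : ℝ → ℝ → ℂ} {r s : ℂ} (h : DoubleMellinConvergent f r s) :
    doubleMellin f r s = ∫ x : ℝ × ℝ, (x.1 : ℂ) ^ (r - 1) * (x.2 : ℂ) ^ (s - 1) * f x.1 x.2
      ∂((volume.restrict (Ioi 0)).prod (volume.restrict (Ioi 0))) := by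
  rw [DoubleMellinConvergent, IntegrableOn, restrict_Ioi_prod_Ioi] at h
  rw [integral_prod_symm _ h]
  simp only [doubleMellin, mellin, smul_eq_mul]
  congr 1; funext q
  rw [← integral_const_mul]
  congr 1; funext p
  ring

/-- Dilating a function by `κ ≤ 1` multiplies its Mellin transform by `κ ^ r`. -/
theorem HasMellin.comp_inv_mul {e : ℝ → ℂ} {r m : ℂ} (h : HasMellin e r m) (hr : 0 < r.re)
    {κ : ℝ} (hκ : 0 < κ) (hκ1 : κ ≤ 1) :
    HasMellin (fun p => e (κ⁻¹ * p)) r ((κ : ℂ) ^ r * m) ∧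
    ∫ p in Ioi (0 : ℝ), ‖(p : ℂ) ^ (r - 1) * e (κ⁻¹ * p)‖ ≤
      ∫ p in Ioi (0 : ℝ), ‖(p : ℂ) ^ (r - 1) * e p‖ := by
  refine ⟨⟨(MellinConvergent.comp_mul_left (inv_pos.2 hκ)).2 h.1, ?_⟩, ?_⟩
  · rw [mellin_comp_mul_left _ _ (inv_pos.2 hκ), h.2, smul_eq_mul, Complex.ofReal_inv,
      Complex.inv_cpow _ _ (by rw [Complex.arg_ofReal_of_nonneg hκ.le]; exact Real.pi_pos.ne),
      Complex.cpow_neg, inv_inv]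
  · set g : ℝ → ℝ := fun p => ‖(p : ℂ) ^ (r - 1) * e p‖ with hg
    have h1 : ∫ p in Ioi (0 : ℝ), ‖(p : ℂ) ^ (r - 1) * e (κ⁻¹ * p)‖ =
        ∫ p in Ioi (0 : ℝ), κ ^ (r.re - 1) * g (κ⁻¹ * p) := by
      refine setIntegral_congr_fun measurableSet_Ioi fun p hp => ?_
      have hp' : 0 < p := hp
      simp only [hg, norm_mul]
      rw [Complex.norm_cpow_eq_rpow_re_of_pos hp',
        Complex.norm_cpow_eq_rpow_re_of_pos (by positivity), Real.mul_rpow (by positivity) hp'.le,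
        Real.inv_rpow hκ.le]
      have : κ ^ (r - 1).re ≠ 0 := (Real.rpow_pos_of_pos hκ _).ne'
      simp only [Complex.sub_re, Complex.one_re] at this ⊢
      field_simp
    rw [h1, integral_const_mul, integral_comp_mul_left_Ioi g 0 (inv_pos.2 hκ), mul_zero, inv_inv,
      smul_eq_mul, ← mul_assoc, ← Real.rpow_add_one hκ.ne', sub_add_cancel]
    refine mul_le_of_le_one_left (integral_nonneg fun _ => norm_nonneg _) ?_
    exact Real.rpow_le_one hκ.le hκ1 hr.le

/-! ### Complex exponentials and the damped cosine -/

theorem mellinConvergent_exp_neg_mul {s ζ : ℂ} (hs : 0 < s.re) (hζ : 0 < ζ.re) :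
    MellinConvergent (fun u : ℝ => Complex.exp (-(ζ * u))) s := by
  have hb := integrableOn_rpow_mul_exp_neg_mul_rpow (p := 1) (s := s.re - 1) (b := ζ.re)
    (by linarith) one_pos hζ
  refine Integrable.mono' hb ?_ ((ae_restrict_iff' measurableSet_Ioi).2
    (Eventually.of_forall fun u hu => ?_))
  · refine Measurable.aestronglyMeasurable ?_
    simp only [smul_eq_mul]
    fun_prop
  · have hu' : 0 < u := hu
    rw [norm_smul, Complex.norm_cpow_eq_rpow_re_of_pos hu', Complex.norm_exp, Real.rpow_one]
    simp

theorem differentiableAt_mellin_exp_neg_mul {s ζ : ℂ} (hs : 0 < s.re) (hζ : 0 < ζ.re) :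
    DifferentiableAt ℂ (fun ξ : ℂ => mellin (fun u : ℝ => Complex.exp (-(ξ * u))) s) ζ := by
  have hb := integrableOn_rpow_mul_exp_neg_mul_rpow (p := 1) (s := s.re) (b := ζ.re / 2)
    (by linarith) one_pos (by linarith)
  have hU : {ξ : ℂ | ζ.re / 2 < ξ.re} ∈ 𝓝 ζ :=
    (isOpen_lt continuous_const Complex.continuous_re).mem_nhds (by simp; linarith)
  have hmeas : ∀ ξ : ℂ, AEStronglyMeasurable
      (fun u : ℝ => (u : ℂ) ^ (s - 1) • Complex.exp (-(ξ * u))) (volume.restrict (Ioi 0)) :=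
    fun ξ => by
      refine Measurable.aestronglyMeasurable ?_
      simp only [smul_eq_mul]
      fun_prop
  refine (hasDerivAt_integral_of_dominated_loc_of_deriv_le (μ := volume.restrict (Ioi (0 : ℝ)))
    (F := fun (ξ : ℂ) (u : ℝ) => (u : ℂ) ^ (s - 1) • Complex.exp (-(ξ * u)))
    (F' := fun (ξ : ℂ) (u : ℝ) => (u : ℂ) ^ (s - 1) • (Complex.exp (-(ξ * u)) * -u)) hU
    (Eventually.of_forall hmeas) (mellinConvergent_exp_neg_mul hs hζ) ?_ ?_ hb
    ?_).2.differentiableAt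
  · refine Measurable.aestronglyMeasurable ?_
    simp only [smul_eq_mul]
    fun_prop
  · refine (ae_restrict_iff' measurableSet_Ioi).2 (Eventually.of_forall fun u hu ξ hξ => ?_)
    have hu' : 0 < u := hu
    rw [norm_smul, norm_mul, norm_neg, Complex.norm_real, Real.norm_of_nonneg hu'.le,
      Complex.norm_cpow_eq_rpow_re_of_pos hu', Complex.norm_exp, Real.rpow_one]
    have h1 : u ^ (s - 1).re * u = u ^ s.re := by
      rw [← Real.rpow_add_one hu'.ne']; simp
    have h2 : (-(ξ * u) : ℂ).re = -(ξ.re * u) := by simp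
    have h3 : ζ.re / 2 < ξ.re := hξ
    rw [h2, mul_comm (Real.exp _) u, ← mul_assoc, h1]
    gcongr
    nlinarith
  · refine Eventually.of_forall fun u ξ _ => ?_
    have h := (((hasDerivAt_id ξ).mul_const (u : ℂ)).neg.cexp).const_mul ((u : ℂ) ^ (s - 1))
    simpa using h

/-- The Mellin transform of `u ↦ exp (-ζ u)` for complex `ζ` in the right half plane. -/
theorem hasMellin_exp_neg_mul {s ζ : ℂ} (hs : 0 < s.re) (hζ : 0 < ζ.re) :
    HasMellin (fun u : ℝ => Complex.exp (-(ζ * u))) s (Complex.Gamma s * ζ ^ (-s)) := by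
  refine ⟨mellinConvergent_exp_neg_mul hs hζ, ?_⟩
  set U : Set ℂ := {ξ : ℂ | 0 < ξ.re} with hU
  have hUo : IsOpen U := isOpen_lt continuous_const Complex.continuous_re
  have hUc : IsPreconnected U := (convex_halfSpace_re_gt 0).isPreconnected
  have hf : AnalyticOnNhd ℂ (fun ξ : ℂ => mellin (fun u : ℝ => Complex.exp (-(ξ * u))) s) U :=
    DifferentiableOn.analyticOnNhd (fun ξ hξ =>
      (differentiableAt_mellin_exp_neg_mul hs hξ).differentiableWithinAt) hUo
  have hg : AnalyticOnNhd ℂ (fun ξ : ℂ => Complex.Gamma s * ξ ^ (-s)) U :=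
    DifferentiableOn.analyticOnNhd (fun ξ hξ => (DifferentiableAt.const_mul
      (DifferentiableAt.cpow_const differentiableAt_id (Or.inl hξ)) _).differentiableWithinAt) hUo
  have hreal : ∀ x : ℝ, 0 < x → mellin (fun u : ℝ => Complex.exp (-((x : ℂ) * u))) s =
      Complex.Gamma s * (x : ℂ) ^ (-s) := by
    intro x hx
    rw [mellin]
    simp only [smul_eq_mul]
    rw [Complex.integral_cpow_mul_exp_neg_mul_Ioi hs hx, one_div, Complex.inv_cpow _ _
      (by rw [Complex.arg_ofReal_of_nonneg hx.le]; exact Real.pi_pos.ne), Complex.cpow_neg, mul_comm]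
  -- Identity theorem: both sides are analytic on the right half plane and agree at the real points
  -- `1 + 1/(n+1)`, which accumulate at 1.
  refine hf.eqOn_of_preconnected_of_frequently_eq hg hUc (z₀ := 1) (by simp [hU]) ?_ hζ
  have htend : Tendsto (fun n : ℕ => ((1 + 1 / ((n : ℝ) + 1) : ℝ) : ℂ)) atTop (𝓝[≠] 1) := by
    refine tendsto_nhdsWithin_iff.2 ⟨?_, Eventually.of_forall fun n => ?_⟩
    · have := (tendsto_one_div_add_atTop_nhds_zero_nat (𝕜 := ℝ)).const_add 1
      rw [add_zero] at this
      exact (Complex.continuous_ofReal.tendsto' 1 1 Complex.ofReal_one).comp this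
    · have : (0 : ℝ) < 1 / ((n : ℝ) + 1) := by positivity
      have h2 : (1 + 1 / ((n : ℝ) + 1) : ℝ) ≠ 1 := by linarith
      exact fun h => h2 (Complex.ofReal_eq_one.1 h)
  exact htend.frequently (Frequently.of_forall fun n => hreal _ (by positivity))

theorem mittagLeffler_two_neg {x : ℝ} (hx : 0 ≤ x) :
    mittagLeffler 2 (-(x : ℂ)) = Complex.cos (√x : ℝ) := by
  rw [← mittagLeffler_two_neg_sq, ← Complex.ofReal_pow, Real.sq_sqrt hx]

/-- The Mellin transform at `r` of `x ↦ exp (-ε √x) cos √x`. -/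
noncomputable def dampedCosMellin (r : ℂ) (ε : ℝ) : ℂ :=
  Complex.Gamma (2 * r) * ((ε + Complex.I) ^ (-(2 * r)) + (ε - Complex.I) ^ (-(2 * r)))

/-- The bases `ε ± i` have nonzero imaginary part and so avoid the branch cut even at `ε = 0`; this
lets the damping be removed. -/
theorem continuous_dampedCosMellin (r : ℂ) : Continuous (dampedCosMellin r) := by
  refine continuous_const.mul (Continuous.add ?_ ?_)
  · refine Continuous.cpow (by fun_prop) continuous_const fun ε => Or.inr ?_
    simp
  · refine Continuous.cpow (by fun_prop) continuous_const fun ε => Or.inr ?_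
    simp

/-- The reflection formula in a form that survives the poles of `Γ(1 - w)`: there both sides are 0.
-/
theorem Complex.inv_Gamma_one_sub {w : ℂ} (hw : 0 < w.re) :
    (Complex.Gamma (1 - w))⁻¹ = Complex.Gamma w * Complex.sin (Real.pi * w) / Real.pi := by
  have h := Complex.Gamma_mul_Gamma_one_sub w
  have hG := Complex.Gamma_ne_zero_of_re_pos hw
  by_cases h0 : Complex.Gamma (1 - w) = 0
  · obtain ⟨m, hm⟩ := (Complex.Gamma_eq_zero_iff _).1 h0
    have hwm : w = ((m + 1 : ℕ) : ℂ) := by push_cast; linear_combination -hm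
    have hs : Complex.sin (Real.pi * w) = 0 := by
      rw [hwm, mul_comm]; exact Complex.sin_nat_mul_pi _
    rw [h0, hs]; simp
  · have hs : Complex.sin (Real.pi * w) ≠ 0 := fun hs => by
      rw [hs, div_zero] at h
      exact mul_ne_zero hG h0 h
    rw [eq_div_iff hs] at h
    rw [inv_eq_iff_eq_inv, inv_div, eq_div_iff (mul_ne_zero hG hs)]
    linear_combination h

/-- `i^(-2r) + (-i)^(-2r) = 2 cos(πr)`, while reflection at `2r` and `sin(2πr) = 2 sin(πr) cos(πr)`
bring the right side to `2 Γ(2r) cos(πr)` too. -/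
theorem dampedCosMellin_zero {r : ℂ} (hr : 0 < r.re) (hsin : Complex.sin (Real.pi * r) ≠ 0) :
    dampedCosMellin r 0 = mittagLefflerMellin 2 r := by
  have hpi : (Real.pi : ℂ) ≠ 0 := by exact_mod_cast Real.pi_ne_zero
  have hsin' : Complex.sin (r * Real.pi) ≠ 0 := by rwa [mul_comm]
  rw [dampedCosMellin, mittagLefflerMellin]
  push_cast
  rw [Complex.inv_Gamma_one_sub (by simpa using hr), show (Real.pi : ℂ) * (2 * r) =
    2 * (Real.pi * r) by ring, Complex.sin_two_mul, zero_add, zero_sub,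
    Complex.cpow_def_of_ne_zero Complex.I_ne_zero,
    Complex.cpow_def_of_ne_zero (neg_ne_zero.2 Complex.I_ne_zero), Complex.log_I,
    Complex.log_neg_I, Complex.cos]
  rw [show (Real.pi / 2 * Complex.I * -(2 * r) : ℂ) = -(Real.pi * r) * Complex.I by ring,
    show (-(Real.pi / 2) * Complex.I * -(2 * r) : ℂ) = Real.pi * r * Complex.I by ring]
  field_simp
  ring

/-- With `u = √x` the function is half the sum of `e^(-(ε ± i)u)`, and the substitution doubles the
Mellin variable. -/
theorem hasMellin_damped_mittagLeffler_two {r : ℂ} (hr : 0 < r.re) {ε : ℝ} (hε : 0 < ε) :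
    HasMellin (fun x : ℝ => (Real.exp (-(ε * √x)) : ℂ) * mittagLeffler 2 (-(x : ℂ))) r
      (dampedCosMellin r ε) := by
  have h2r : 0 < (2 * r).re := by simpa using hr
  have h1 := hasMellin_exp_neg_mul (ζ := ε + Complex.I) h2r (by simpa using hε)
  have h2 := hasMellin_exp_neg_mul (ζ := ε - Complex.I) h2r (by simpa using hε)
  have h3 := hasMellin_add h1.1 h2.1
  have h4 := hasMellin_const_smul h3.1 (2⁻¹ : ℂ)
  rw [h3.2, h1.2, h2.2] at h4
  set g : ℝ → ℂ := fun u => (2⁻¹ : ℂ) • (Complex.exp (-((ε + Complex.I) * u)) +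
    Complex.exp (-((ε - Complex.I) * u))) with hg
  have hr2 : r / ((1 / 2 : ℝ) : ℂ) = 2 * r := by push_cast; ring
  have heq : ∀ x ∈ Ioi (0 : ℝ), (Real.exp (-(ε * √x)) : ℂ) * mittagLeffler 2 (-(x : ℂ)) =
      g (x ^ (1 / 2 : ℝ)) := by
    intro x hx
    rw [mittagLeffler_two_neg (le_of_lt hx), ← Real.sqrt_eq_rpow, Complex.cos, hg]
    simp only [smul_eq_mul]
    rw [show -((ε + Complex.I) * (√x : ℝ)) = -(ε * (√x : ℝ)) + -(√x : ℝ) * Complex.I by ring,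
      show -((ε - Complex.I) * (√x : ℝ)) = -(ε * (√x : ℝ)) + (√x : ℝ) * Complex.I by ring,
      Complex.exp_add, Complex.exp_add]
    push_cast
    ring
  constructor
  · have := (MellinConvergent.comp_rpow (f := g) (s := r) (a := 1 / 2) (by norm_num)).2
      (by rw [hr2]; exact h4.1)
    refine IntegrableOn.congr_fun this (fun x hx => ?_) measurableSet_Ioi
    simp only
    rw [heq x hx]
  · have h5 : mellin (fun x : ℝ => (Real.exp (-(ε * √x)) : ℂ) * mittagLeffler 2 (-(x : ℂ))) r =
        mellin (fun x : ℝ => g (x ^ (1 / 2 : ℝ))) r := by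
      refine setIntegral_congr_fun measurableSet_Ioi fun x hx => ?_
      simp only
      rw [heq x hx]
    rw [h5, mellin_comp_rpow, hr2, h4.2, dampedCosMellin, smul_eq_mul, Complex.real_smul]
    rw [abs_of_pos (by norm_num)]
    push_cast
    ring

/-! ### Integral representation of `Φ_{p,q}` -/

/-- The integrand of Euler's integral for the confluent hypergeometric function. -/
noncomputable def confluentWeight (a b z : ℂ) (t : ℝ) : ℂ :=
  (t : ℂ) ^ (a - 1) * (1 - (t : ℂ)) ^ (b - 1) * Complex.exp (z * t)

theorem integrable_confluentWeight {a b : ℂ} (ha : 0 < a.re) (hb : 0 < b.re) (z : ℂ) :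
    IntegrableOn (confluentWeight a b z) (Ioo 0 1) := by
  have h := Complex.betaIntegral_convergent ha hb
  have h2 : IntervalIntegrable (confluentWeight a b z) volume 0 1 :=
    h.mul_continuousOn (by fun_prop)
  rw [intervalIntegrable_iff_integrableOn_Ioo_of_le zero_le_one] at h2
  exact h2

theorem integral_confluentWeight {a b : ℂ} (ha : 0 < a.re) (hb : 0 < b.re) (z : ℂ) :
    ∫ t in Ioo (0 : ℝ) 1, confluentWeight a b z t =
      Complex.betaIntegral a b * confluent a (a + b) z := by
  rw [betaIntegral_mul_confluent ha hb, intervalIntegral.integral_of_le zero_le_one,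
    integral_Ioc_eq_integral_Ioo]
  rfl

theorem ofReal_rpow_cpow {t : ℝ} (ht : 0 < t) (σ : ℝ) (r : ℂ) :
    ((t ^ σ : ℝ) : ℂ) ^ r = (t : ℂ) ^ (σ * r) := by
  have h1 : ((t ^ σ : ℝ) : ℂ) ≠ 0 := by exact_mod_cast (Real.rpow_pos_of_pos ht σ).ne'
  have h2 : (t : ℂ) ≠ 0 := by exact_mod_cast ht.ne'
  rw [Complex.cpow_def_of_ne_zero h1, Complex.cpow_def_of_ne_zero h2, ← Complex.ofReal_log
    (Real.rpow_pos_of_pos ht σ).le, ← Complex.ofReal_log ht.le, Real.log_rpow ht]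
  push_cast
  ring_nf

theorem confluentWeight_mul_cpow {a b z u v : ℂ} {t : ℝ} (ht : t ∈ Ioo (0 : ℝ) 1) :
    confluentWeight a b z t * ((t : ℂ) ^ u * ((1 - t : ℝ) : ℂ) ^ v) =
      confluentWeight (a + u) (b + v) z t := by
  have h1 : (t : ℂ) ≠ 0 := by exact_mod_cast ht.1.ne'
  have h2 : (1 - t : ℂ) ≠ 0 := by
    have : (1 - t : ℝ) ≠ 0 := by linarith [ht.2]
    exact_mod_cast this
  rw [confluentWeight, confluentWeight, show a + u - 1 = (a - 1) + u by ring,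
    show b + v - 1 = (b - 1) + v by ring, Complex.cpow_add _ _ h1, Complex.cpow_add _ _ h2]
  push_cast
  ring

/-- On `(0,1]` the product of the two kernels is bounded, so the beta weight dominates and the
exponential series may be integrated termwise. -/
theorem extConfluent_eq_integral {lam σ τ : ℝ} (hlam : 0 < lam) (hlam2 : lam ≤ 2)
    {a c z : ℂ} (ha : 0 < a.re) (hc : a.re < c.re) {p q : ℝ} (hp : 0 < p) (hq : 0 < q) :
    (∀ n : ℕ, IntervalIntegrable (extBetaIntegrand lam σ τ p q (a + (n : ℂ)) (c - a)) volume 0 1) ∧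
    Summable (extConfluentTerm lam σ τ p q a c z) ∧
    extConfluent lam σ τ p q a c z = (Complex.betaIntegral a (c - a))⁻¹ *
      ∫ t in Ioo (0 : ℝ) 1, confluentWeight a (c - a) z t *
        (mittagLeffler lam (-(((t ^ σ)⁻¹ * p : ℝ) : ℂ)) *
          mittagLeffler lam (-((((1 - t) ^ τ)⁻¹ * q : ℝ) : ℂ))) := by
  have hb : 0 < (c - a).re := by simpa using hc
  obtain ⟨K, hK0, hK⟩ := exists_norm_mittagLeffler_neg_le hlam hlam2
  set k : ℝ → ℂ := fun t => mittagLeffler lam (-(((t ^ σ)⁻¹ * p : ℝ) : ℂ)) *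
    mittagLeffler lam (-((((1 - t) ^ τ)⁻¹ * q : ℝ) : ℂ)) with hk
  have hE := (mittagLeffler_continuous hlam).measurable
  have hkm : Measurable k := by
    refine (hE.comp ?_).mul (hE.comp ?_) <;> fun_prop
  have hkb : ∀ t ∈ Ioc (0 : ℝ) 1, ‖k t‖ ≤ K * K := by
    intro t ht
    have h1 : 0 ≤ 1 - t := by linarith [ht.2]
    have h0 := ht.1
    rw [hk, norm_mul]
    exact mul_le_mul (hK _ (by positivity)) (hK _ (by positivity)) (norm_nonneg _) hK0
  have hint : IntervalIntegrable
      (fun t : ℝ => (t : ℂ) ^ (a - 1) * (1 - (t : ℂ)) ^ (c - a - 1) * k t) volume 0 1 := by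
    have h := Complex.betaIntegral_convergent ha hb
    rw [intervalIntegrable_iff_integrableOn_Ioc_of_le zero_le_one] at h ⊢
    refine Integrable.mono' (h.norm.mul_const (K * K))
      (h.aestronglyMeasurable.mul hkm.aestronglyMeasurable)
      ((ae_restrict_iff' measurableSet_Ioc).2 (Eventually.of_forall fun t ht => ?_))
    rw [norm_mul]
    exact mul_le_mul_of_nonneg_left (hkb t ht) (norm_nonneg _)
  obtain ⟨h1, h2⟩ := hasSum_integral_beta_weight (z := z) hint
  have hfun : ∀ n : ℕ, extBetaIntegrand lam σ τ p q (a + (n : ℂ)) (c - a) =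
      fun t : ℝ => (t : ℂ) ^ (a + n - 1) * (1 - (t : ℂ)) ^ (c - a - 1) * k t := by
    intro n
    funext t
    rw [extBetaIntegrand, hk, mul_assoc _ (mittagLeffler _ _)]
    simp only [Complex.ofReal_mul, Complex.ofReal_inv, div_eq_inv_mul]
  have hterm : extConfluentTerm lam σ τ p q a c z = fun n : ℕ =>
      (Complex.betaIntegral a (c - a))⁻¹ * ((∫ t in (0 : ℝ)..1,
        (t : ℂ) ^ (a + n - 1) * (1 - (t : ℂ)) ^ (c - a - 1) * k t) *
          (z ^ n / (n.factorial : ℂ))) := by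
    funext n
    rw [extConfluentTerm, extBeta, hfun]
    ring
  have h3 := h2.mul_left (Complex.betaIntegral a (c - a))⁻¹
  rw [← hterm] at h3
  refine ⟨fun n => hfun n ▸ h1 n, h3.summable, ?_⟩
  rw [extConfluent, h3.tsum_eq, intervalIntegral.integral_of_le zero_le_one,
    integral_Ioc_eq_integral_Ioo]
  congr 2; funext t
  rw [confluentWeight]
  ring

theorem ae_pos_prod : ∀ᵐ x : ℝ × ℝ ∂((volume.restrict (Ioi 0)).prod (volume.restrict (Ioi 0))),
    0 < x.1 ∧ 0 < x.2 := by
  rw [← restrict_Ioi_prod_Ioi]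
  filter_upwards [ae_restrict_mem (measurableSet_Ioi.prod measurableSet_Ioi)] with x hx
  exact hx

theorem mellin_integrand_extConfluent_ae_eq {lam σ τ : ℝ} (hlam : 0 < lam) (hlam2 : lam ≤ 2)
    {a c z : ℂ} (ha : 0 < a.re) (hc : a.re < c.re) (r s : ℂ) :
    (fun x : ℝ × ℝ => (x.1 : ℂ) ^ (r - 1) * (x.2 : ℂ) ^ (s - 1) *
      extConfluent lam σ τ x.1 x.2 a c z)
    =ᵐ[(volume.restrict (Ioi 0)).prod (volume.restrict (Ioi 0))]
    fun x => (Complex.betaIntegral a (c - a))⁻¹ *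
      ∫ t in Ioo (0 : ℝ) 1, confluentWeight a (c - a) z t *
        (((x.1 : ℂ) ^ (r - 1) * mittagLeffler lam (-(((t ^ σ)⁻¹ * x.1 : ℝ) : ℂ))) *
          ((x.2 : ℂ) ^ (s - 1) * mittagLeffler lam (-((((1 - t) ^ τ)⁻¹ * x.2 : ℝ) : ℂ)))) := by
  filter_upwards [ae_pos_prod] with x hx
  rw [(extConfluent_eq_integral hlam hlam2 ha hc hx.1 hx.2).2.2, mul_left_comm,
    ← integral_const_mul]
  congr 2; funext t
  ring

/-! ### The double Mellin transform by Fubini -/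

theorem doubleMellin_extConfluent_of_hasMellin {lam σ τ : ℝ} (hlam : 0 < lam) (hlam2 : lam ≤ 2)
    (hσ : 0 < σ) (hτ : 0 < τ) {a c z r s m₁ m₂ : ℂ} (ha : 0 < a.re) (hc : a.re < c.re)
    (hr : 0 < r.re) (hs : 0 < s.re)
    (h₁ : HasMellin (fun x : ℝ => mittagLeffler lam (-(x : ℂ))) r m₁)
    (h₂ : HasMellin (fun x : ℝ => mittagLeffler lam (-(x : ℂ))) s m₂) :
    DoubleMellinConvergent (fun p q : ℝ => extConfluent lam σ τ p q a c z) r s ∧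
    doubleMellin (fun p q : ℝ => extConfluent lam σ τ p q a c z) r s =
      m₁ * m₂ * (Complex.betaIntegral (a + σ * r) (c + τ * s - a) /
        Complex.betaIntegral a (c - a)) * confluent (a + σ * r) (c + σ * r + τ * s) z := by
  have hb : 0 < (c - a).re := by simpa using hc
  have hE := (mittagLeffler_continuous hlam).measurable
  have hae := mellin_integrand_extConfluent_ae_eq (σ := σ) (τ := τ) (z := z) hlam hlam2 ha hc r s
  set k₁ : ℝ → ℝ → ℂ := fun t p =>
    (p : ℂ) ^ (r - 1) * mittagLeffler lam (-(((t ^ σ)⁻¹ * p : ℝ) : ℂ)) with hk₁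
  set k₂ : ℝ → ℝ → ℂ := fun t q =>
    (q : ℂ) ^ (s - 1) * mittagLeffler lam (-((((1 - t) ^ τ)⁻¹ * q : ℝ) : ℂ)) with hk₂
  have hm₁ : Measurable (Function.uncurry k₁) := by
    refine Measurable.mul (by fun_prop) (hE.comp ?_)
    fun_prop
  have hm₂ : Measurable (Function.uncurry k₂) := by
    refine Measurable.mul (by fun_prop) (hE.comp ?_)
    fun_prop
  have hs₁ : ∀ t ∈ Ioo (0 : ℝ) 1, _ := fun t ht => h₁.comp_inv_mul hr
    (Real.rpow_pos_of_pos ht.1 σ) (Real.rpow_le_one ht.1.le ht.2.le hσ.le)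
  have hs₂ : ∀ t ∈ Ioo (0 : ℝ) 1, _ := fun t ht => h₂.comp_inv_mul hs
    (Real.rpow_pos_of_pos (sub_pos.2 ht.2) τ)
    (Real.rpow_le_one (sub_pos.2 ht.2).le (by linarith [ht.1]) hτ.le)
  obtain ⟨hI, hV⟩ := integrable_integral_mul_kernels (ν := volume.restrict (Ioi (0 : ℝ)))
    (integrable_confluentWeight ha hb z) hm₁ hm₂
    ((ae_restrict_iff' measurableSet_Ioo).2 (Eventually.of_forall fun t ht =>
      ⟨(hs₁ t ht).1.1, (hs₁ t ht).2⟩))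
    ((ae_restrict_iff' measurableSet_Ioo).2 (Eventually.of_forall fun t ht =>
      ⟨(hs₂ t ht).1.1, (hs₂ t ht).2⟩))
  have hconv : DoubleMellinConvergent (fun p q : ℝ => extConfluent lam σ τ p q a c z) r s := by
    rw [DoubleMellinConvergent, IntegrableOn, restrict_Ioi_prod_Ioi]
    exact (hI.const_mul _).congr hae.symm
  refine ⟨hconv, ?_⟩
  have ha' : 0 < (a + σ * r).re := by
    rw [Complex.add_re, Complex.re_ofReal_mul]; positivity
  have hb' : 0 < (c - a + τ * s).re := by
    rw [Complex.add_re, Complex.re_ofReal_mul]; positivity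
  have hW : ∫ t in Ioo (0 : ℝ) 1, confluentWeight a (c - a) z t *
      ((∫ p in Ioi (0 : ℝ), k₁ t p) * ∫ q in Ioi (0 : ℝ), k₂ t q) =
      m₁ * m₂ * ∫ t in Ioo (0 : ℝ) 1, confluentWeight (a + σ * r) (c - a + τ * s) z t := by
    rw [← integral_const_mul]
    refine setIntegral_congr_fun measurableSet_Ioo fun t ht => ?_
    have e₁ : ∫ p in Ioi (0 : ℝ), k₁ t p = (t : ℂ) ^ (σ * r) * m₁ := by
      rw [← ofReal_rpow_cpow ht.1]; exact (hs₁ t ht).1.2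
    have e₂ : ∫ q in Ioi (0 : ℝ), k₂ t q = ((1 - t : ℝ) : ℂ) ^ (τ * s) * m₂ := by
      rw [← ofReal_rpow_cpow (sub_pos.2 ht.2)]; exact (hs₂ t ht).1.2
    simp only [e₁, e₂]
    rw [← confluentWeight_mul_cpow ht]
    ring
  rw [doubleMellin_eq_integral hconv, integral_congr_ae hae, integral_const_mul, hV, hW,
    integral_confluentWeight ha' hb', show c + τ * s - a = c - a + τ * s by ring,
    show c + σ * r + τ * s = a + σ * r + (c - a + τ * s) by ring]
  ring

/-! ### The case `λ = 2` by damping -/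

/-- The damping must not depend on `κ`, hence on `t`, so that it factors out of the `t`-integral.
Dilating by `κ` the function damped at rate `ε √κ` achieves this, since `√κ √(p/κ) = √p`. The bound
`A` is uniform because `cos` is bounded. -/
theorem exists_hasMellin_damped_kernel {r : ℂ} (hr : 0 < r.re) {ε : ℝ} (hε : 0 < ε) :
    ∃ A : ℝ, ∀ κ : ℝ, 0 < κ → κ ≤ 1 →
      HasMellin (fun p : ℝ => (Real.exp (-(ε * √p)) : ℂ) *
        mittagLeffler 2 (-((κ⁻¹ * p : ℝ) : ℂ))) r
        ((κ : ℂ) ^ r * dampedCosMellin r (ε * √κ)) ∧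
      ∫ p in Ioi (0 : ℝ), ‖(p : ℂ) ^ (r - 1) * ((Real.exp (-(ε * √p)) : ℂ) *
        mittagLeffler 2 (-((κ⁻¹ * p : ℝ) : ℂ)))‖ ≤ A := by
  obtain ⟨K, hK0, hK⟩ := exists_norm_mittagLeffler_neg_le (lam := 2) (by norm_num) le_rfl
  have hdom : IntegrableOn (fun p : ℝ => ‖(p : ℂ) ^ (r - 1) * (Real.exp (-(ε * √p)) : ℂ)‖)
      (Ioi 0) := by
    have h := mellinConvergent_exp_neg_mul (s := 2 * r) (ζ := ε) (by simpa using hr)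
      (by simpa using hε)
    have h2 := (MellinConvergent.comp_rpow (s := r) (a := 1 / 2) (by norm_num)).2
      (by rw [show r / ((1 / 2 : ℝ) : ℂ) = 2 * r by push_cast; ring]; exact h)
    refine IntegrableOn.congr_fun (Integrable.norm h2) (fun x hx => ?_) measurableSet_Ioi
    simp only [smul_eq_mul]
    rw [← Real.sqrt_eq_rpow]
    push_cast
    rfl
  refine ⟨∫ p in Ioi (0 : ℝ), ‖(p : ℂ) ^ (r - 1) * (Real.exp (-(ε * √p)) : ℂ)‖ * K,
    fun κ hκ hκ1 => ?_⟩
  have h := (hasMellin_damped_mittagLeffler_two hr (ε := ε * √κ) (by positivity)).comp_inv_mul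
    hr hκ hκ1
  have heq : (fun p : ℝ => (Real.exp (-(ε * √κ * √(κ⁻¹ * p))) : ℂ) *
      mittagLeffler 2 (-((κ⁻¹ * p : ℝ) : ℂ))) = fun p : ℝ => (Real.exp (-(ε * √p)) : ℂ) *
        mittagLeffler 2 (-((κ⁻¹ * p : ℝ) : ℂ)) := by
    funext p
    rw [mul_assoc ε, ← Real.sqrt_mul hκ.le, mul_inv_cancel_left₀ hκ.ne']
  have h1 := h.1
  rw [heq] at h1
  refine ⟨h1, setIntegral_mono_on h1.1.norm (hdom.mul_const K) measurableSet_Ioi fun p hp => ?_⟩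
  have hp' : 0 < p := hp
  rw [← mul_assoc, norm_mul _ (mittagLeffler _ _)]
  exact mul_le_mul_of_nonneg_left (hK _ (by positivity)) (norm_nonneg _)

theorem integral_damped_extConfluent {σ τ : ℝ} (hσ : 0 < σ) (hτ : 0 < τ) {a c z r s : ℂ}
    (ha : 0 < a.re) (hc : a.re < c.re) (hr : 0 < r.re) (hs : 0 < s.re) {ε : ℝ} (hε : 0 < ε) :
    ∫ x : ℝ × ℝ, ((Real.exp (-(ε * √x.1)) : ℂ) * (Real.exp (-(ε * √x.2)) : ℂ)) *
      ((x.1 : ℂ) ^ (r - 1) * (x.2 : ℂ) ^ (s - 1) * extConfluent 2 σ τ x.1 x.2 a c z)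
      ∂((volume.restrict (Ioi 0)).prod (volume.restrict (Ioi 0))) =
    (Complex.betaIntegral a (c - a))⁻¹ * ∫ t in Ioo (0 : ℝ) 1,
      confluentWeight (a + σ * r) (c - a + τ * s) z t *
        (dampedCosMellin r (ε * √(t ^ σ)) * dampedCosMellin s (ε * √((1 - t) ^ τ))) := by
  have hE := (mittagLeffler_continuous (lam := 2) (by norm_num)).measurable
  have hae := mellin_integrand_extConfluent_ae_eq (σ := σ) (τ := τ) (z := z) (lam := 2)
    (by norm_num) le_rfl ha hc r s
  set k₁ : ℝ → ℝ → ℂ := fun t p => (p : ℂ) ^ (r - 1) * ((Real.exp (-(ε * √p)) : ℂ) *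
    mittagLeffler 2 (-(((t ^ σ)⁻¹ * p : ℝ) : ℂ))) with hk₁
  set k₂ : ℝ → ℝ → ℂ := fun t q => (q : ℂ) ^ (s - 1) * ((Real.exp (-(ε * √q)) : ℂ) *
    mittagLeffler 2 (-((((1 - t) ^ τ)⁻¹ * q : ℝ) : ℂ))) with hk₂
  have hm₁ : Measurable (Function.uncurry k₁) := by
    refine Measurable.mul (by fun_prop) (Measurable.mul (by fun_prop) (hE.comp ?_))
    fun_prop
  have hm₂ : Measurable (Function.uncurry k₂) := by
    refine Measurable.mul (by fun_prop) (Measurable.mul (by fun_prop) (hE.comp ?_))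
    fun_prop
  obtain ⟨A₁, hA₁⟩ := exists_hasMellin_damped_kernel hr hε
  obtain ⟨A₂, hA₂⟩ := exists_hasMellin_damped_kernel hs hε
  have hs₁ : ∀ t ∈ Ioo (0 : ℝ) 1, _ := fun t ht => hA₁ (t ^ σ)
    (Real.rpow_pos_of_pos ht.1 σ) (Real.rpow_le_one ht.1.le ht.2.le hσ.le)
  have hs₂ : ∀ t ∈ Ioo (0 : ℝ) 1, _ := fun t ht => hA₂ ((1 - t) ^ τ)
    (Real.rpow_pos_of_pos (sub_pos.2 ht.2) τ)
    (Real.rpow_le_one (sub_pos.2 ht.2).le (by linarith [ht.1]) hτ.le)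
  have hV := (integrable_integral_mul_kernels (ν := volume.restrict (Ioi (0 : ℝ)))
    (integrable_confluentWeight ha (by simpa using hc : 0 < (c - a).re) z) hm₁ hm₂
    ((ae_restrict_iff' measurableSet_Ioo).2 (Eventually.of_forall fun t ht =>
      ⟨(hs₁ t ht).1.1, (hs₁ t ht).2⟩))
    ((ae_restrict_iff' measurableSet_Ioo).2 (Eventually.of_forall fun t ht =>
      ⟨(hs₂ t ht).1.1, (hs₂ t ht).2⟩))).2
  have hW : ∫ t in Ioo (0 : ℝ) 1, confluentWeight a (c - a) z t *
      ((∫ p in Ioi (0 : ℝ), k₁ t p) * ∫ q in Ioi (0 : ℝ), k₂ t q) =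
      ∫ t in Ioo (0 : ℝ) 1, confluentWeight (a + σ * r) (c - a + τ * s) z t *
        (dampedCosMellin r (ε * √(t ^ σ)) * dampedCosMellin s (ε * √((1 - t) ^ τ))) := by
    refine setIntegral_congr_fun measurableSet_Ioo fun t ht => ?_
    have e₁ : ∫ p in Ioi (0 : ℝ), k₁ t p =
        (t : ℂ) ^ (σ * r) * dampedCosMellin r (ε * √(t ^ σ)) := by
      rw [← ofReal_rpow_cpow ht.1]; exact (hs₁ t ht).1.2
    have e₂ : ∫ q in Ioi (0 : ℝ), k₂ t q =
        ((1 - t : ℝ) : ℂ) ^ (τ * s) * dampedCosMellin s (ε * √((1 - t) ^ τ)) := by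
      rw [← ofReal_rpow_cpow (sub_pos.2 ht.2)]; exact (hs₂ t ht).1.2
    simp only [e₁, e₂]
    rw [← confluentWeight_mul_cpow ht]
    ring
  rw [← hW, ← hV, ← integral_const_mul]
  refine integral_congr_ae ?_
  filter_upwards [hae] with x hx
  rw [hx, mul_left_comm, ← integral_const_mul]
  congr 2; funext t
  simp only [hk₁, hk₂]
  ring

theorem doubleMellin_extConfluent_two {σ τ : ℝ} (hσ : 0 < σ) (hτ : 0 < τ) {a c z r s : ℂ}
    (ha : 0 < a.re) (hc : a.re < c.re) (hr : 0 < r.re) (hs : 0 < s.re)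
    (hsr : Complex.sin (Real.pi * r) ≠ 0) (hss : Complex.sin (Real.pi * s) ≠ 0)
    (h : DoubleMellinConvergent (fun p q : ℝ => extConfluent 2 σ τ p q a c z) r s) :
    doubleMellin (fun p q : ℝ => extConfluent 2 σ τ p q a c z) r s =
      mittagLefflerMellin 2 r * mittagLefflerMellin 2 s *
        (Complex.betaIntegral (a + σ * r) (c + τ * s - a) / Complex.betaIntegral a (c - a)) *
        confluent (a + σ * r) (c + σ * r + τ * s) z := by
  have hb : 0 < (c - a).re := by simpa using hc
  have ha' : 0 < (a + σ * r).re := by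
    rw [Complex.add_re, Complex.re_ofReal_mul]; positivity
  have hb' : 0 < (c - a + τ * s).re := by
    rw [Complex.add_re, Complex.re_ofReal_mul]; positivity
  rw [doubleMellin_eq_integral h]
  rw [DoubleMellinConvergent, IntegrableOn, restrict_Ioi_prod_Ioi] at h
  set G : ℝ × ℝ → ℂ := fun x => (x.1 : ℂ) ^ (r - 1) * (x.2 : ℂ) ^ (s - 1) *
    extConfluent 2 σ τ x.1 x.2 a c z with hG
  have hε : Tendsto (fun n : ℕ => 1 / ((n : ℝ) + 1)) atTop (𝓝 0) :=
    tendsto_one_div_add_atTop_nhds_zero_nat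
  have hεpos : ∀ n : ℕ, 0 < 1 / ((n : ℝ) + 1) := fun n => by positivity
  have hεle : ∀ n : ℕ, 1 / ((n : ℝ) + 1) ≤ 1 := fun n => by
    rw [div_le_one (by positivity)]
    have : (0 : ℝ) ≤ n := by positivity
    linarith
  -- The damping factors are at most 1, so the assumed absolute convergence supplies the dominating
  -- function.
  have hleft : Tendsto (fun n : ℕ => ∫ x : ℝ × ℝ, ((Real.exp (-(1 / ((n : ℝ) + 1) * √x.1)) : ℂ) *
      (Real.exp (-(1 / ((n : ℝ) + 1) * √x.2)) : ℂ)) * G x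
      ∂((volume.restrict (Ioi 0)).prod (volume.restrict (Ioi 0)))) atTop
      (𝓝 (∫ x, G x ∂((volume.restrict (Ioi 0)).prod (volume.restrict (Ioi 0))))) := by
    refine tendsto_integral_of_dominated_convergence (fun x => ‖G x‖) (fun n => ?_) h.norm
      (fun n => Eventually.of_forall fun x => ?_) (Eventually.of_forall fun x => ?_)
    · refine AEStronglyMeasurable.mul (Measurable.aestronglyMeasurable ?_) h.aestronglyMeasurable
      fun_prop
    · have hle : ∀ y : ℝ, ‖(Real.exp (-(1 / ((n : ℝ) + 1) * √y)) : ℂ)‖ ≤ 1 := fun y => by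
        rw [Complex.norm_real, Real.norm_of_nonneg (Real.exp_pos _).le, Real.exp_le_one_iff]
        have := mul_nonneg (hεpos n).le (Real.sqrt_nonneg y)
        linarith
      rw [norm_mul, norm_mul]
      exact mul_le_of_le_one_left (norm_nonneg _)
        (mul_le_one₀ (hle _) (norm_nonneg _) (hle _))
    · have hlim : ∀ y : ℝ, Tendsto (fun n : ℕ => (Real.exp (-(1 / ((n : ℝ) + 1) * √y)) : ℂ)) atTop
          (𝓝 1) := fun y => by
        have hc : Continuous fun ε : ℝ => (Real.exp (-(ε * √y)) : ℂ) := by fun_prop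
        exact (hc.tendsto' 0 1 (by simp)).comp hε
      simpa using ((hlim x.1).mul (hlim x.2)).mul_const (G x)
  obtain ⟨C₁, hC₁⟩ := isCompact_Icc.exists_bound_of_continuousOn (s := Icc (0 : ℝ) 1)
    (continuous_dampedCosMellin r).continuousOn
  obtain ⟨C₂, hC₂⟩ := isCompact_Icc.exists_bound_of_continuousOn (s := Icc (0 : ℝ) 1)
    (continuous_dampedCosMellin s).continuousOn
  have hC₁0 : 0 ≤ C₁ := (norm_nonneg _).trans (hC₁ 0 (by simp))
  -- The damping parameters stay in `[0,1]`, where the continuous transforms are bounded, so a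
  -- multiple of the shifted beta weight dominates.
  have hright : Tendsto (fun n : ℕ => ∫ t in Ioo (0 : ℝ) 1,
      confluentWeight (a + σ * r) (c - a + τ * s) z t *
        (dampedCosMellin r (1 / ((n : ℝ) + 1) * √(t ^ σ)) *
          dampedCosMellin s (1 / ((n : ℝ) + 1) * √((1 - t) ^ τ)))) atTop
      (𝓝 (∫ t in Ioo (0 : ℝ) 1, confluentWeight (a + σ * r) (c - a + τ * s) z t *
        (dampedCosMellin r 0 * dampedCosMellin s 0))) := by
    have hw := integrable_confluentWeight ha' hb' z
    refine tendsto_integral_of_dominated_convergence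
      (fun t => ‖confluentWeight (a + σ * r) (c - a + τ * s) z t‖ * (C₁ * C₂)) (fun n => ?_)
      (hw.norm.mul_const _) (fun n => ?_) (Eventually.of_forall fun t => ?_)
    · refine hw.aestronglyMeasurable.mul (Measurable.aestronglyMeasurable ?_)
      refine ((continuous_dampedCosMellin r).measurable.comp ?_).mul
        ((continuous_dampedCosMellin s).measurable.comp ?_) <;> fun_prop
    · refine (ae_restrict_iff' measurableSet_Ioo).2 (Eventually.of_forall fun t ht => ?_)
      have hmem : ∀ y ρ : ℝ, 0 < y → y < 1 → 0 < ρ →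
          1 / ((n : ℝ) + 1) * √(y ^ ρ) ∈ Icc (0 : ℝ) 1 := fun y ρ hy0 hy1 hρ =>
        ⟨by positivity, mul_le_one₀ (hεle n) (Real.sqrt_nonneg _)
          (Real.sqrt_le_one.2 (Real.rpow_le_one hy0.le hy1.le hρ.le))⟩
      rw [norm_mul, norm_mul]
      refine mul_le_mul_of_nonneg_left (mul_le_mul (hC₁ _ (hmem _ _ ht.1 ht.2 hσ))
        (hC₂ _ (hmem _ _ (sub_pos.2 ht.2) (by linarith [ht.1]) hτ)) (norm_nonneg _) hC₁0)
        (norm_nonneg _)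
    · have hlim : ∀ (ρ : ℂ) (y : ℝ), Tendsto (fun n : ℕ =>
          dampedCosMellin ρ (1 / ((n : ℝ) + 1) * y)) atTop (𝓝 (dampedCosMellin ρ 0)) := fun ρ y =>
        ((continuous_dampedCosMellin ρ).tendsto 0).comp (by simpa using hε.mul_const y)
      exact ((hlim r _).mul (hlim s _)).const_mul _
  have hlimit := tendsto_nhds_unique hleft ((hright.const_mul
    (Complex.betaIntegral a (c - a))⁻¹).congr fun n =>
      (integral_damped_extConfluent hσ hτ ha hc hr hs (hεpos n)).symm)
  rw [hlimit, integral_mul_const, integral_confluentWeight ha' hb', dampedCosMellin_zero hr hsr,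
    dampedCosMellin_zero hs hss, show c + τ * s - a = c - a + τ * s by ring,
    show c + σ * r + τ * s = a + σ * r + (c - a + τ * s) by ring]
  ring

/-! ### The case `λ = 1` and the theorem -/

theorem hasMellin_mittagLeffler_one {r : ℂ} (hr : 0 < r.re) :
    HasMellin (fun x : ℝ => mittagLeffler 1 (-(x : ℂ))) r (Complex.Gamma r) := by
  have h := hasMellin_exp_neg_mul (ζ := 1) hr (by simp)
  simpa [mittagLeffler_one] using h

theorem mittagLefflerMellin_one {r : ℂ} (hr : 0 < r.re) (hsin : Complex.sin (Real.pi * r) ≠ 0) :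
    mittagLefflerMellin 1 r = Complex.Gamma r := by
  have hpi : (Real.pi : ℂ) ≠ 0 := by exact_mod_cast Real.pi_ne_zero
  rw [mittagLefflerMellin, Complex.ofReal_one, one_mul, Complex.inv_Gamma_one_sub hr,
    div_mul_div_comm, div_eq_iff (mul_ne_zero hsin hpi)]
  ring

theorem mainTheorem6 (lam σ τ : ℝ) (hlam : 0 < lam) (hlam_le : lam ≤ 2)
    (hσ : 0 < σ) (hτ : 0 < τ)
    (η₂ η₃ z r s : ℂ) (hη₂ : 0 < η₂.re) (hη₃ : η₂.re < η₃.re)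
    (hr : 0 < r.re) (hs : 0 < s.re)
    (hstrip : lam = 1 ∨ (r.re < 1 ∧ s.re < 1)) :
    -- the function to be transformed is well defined for all positive `p` and `q`
    (∀ p q : ℝ, 0 < p → 0 < q →
      (∀ n : ℕ, IntervalIntegrable
        (extBetaIntegrand lam σ τ p q (η₂ + (n : ℂ)) (η₃ - η₂)) MeasureTheory.volume 0 1) ∧
      Summable (extConfluentTerm lam σ τ p q η₂ η₃ z)) ∧
    -- absolute convergence of the double Mellin integral
    (lam < 2 →
      DoubleMellinConvergent (fun p q : ℝ => extConfluent lam σ τ p q η₂ η₃ z) r s) ∧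
    -- the formula
    ((lam < 2 ∨
        DoubleMellinConvergent (fun p q : ℝ => extConfluent lam σ τ p q η₂ η₃ z) r s) →
      Complex.sin (Real.pi * r) ≠ 0 → Complex.sin (Real.pi * s) ≠ 0 →
      doubleMellin (fun p q : ℝ => extConfluent lam σ τ p q η₂ η₃ z) r s =
        (Real.pi : ℂ) ^ 2 /
            (Complex.sin (Real.pi * r) * Complex.sin (Real.pi * s) *
              Complex.Gamma (1 - r * lam) * Complex.Gamma (1 - s * lam)) *
          (Complex.betaIntegral (η₂ + σ * r) (η₃ + τ * s - η₂) /
            Complex.betaIntegral η₂ (η₃ - η₂)) *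
          confluent (η₂ + σ * r) (η₃ + σ * r + τ * s) z) ∧
    -- for `lam = 1` the prefactor extends continuously to integral `r`, `s` as `Γ(r) Γ(s)`
    (lam = 1 →
      doubleMellin (fun p q : ℝ => extConfluent lam σ τ p q η₂ η₃ z) r s =
        Complex.Gamma r * Complex.Gamma s *
          (Complex.betaIntegral (η₂ + σ * r) (η₃ + τ * s - η₂) /
            Complex.betaIntegral η₂ (η₃ - η₂)) *
          confluent (η₂ + σ * r) (η₃ + σ * r + τ * s) z) := by
  -- At its poles `Complex.Gamma` takes the value 0 and division by 0 gives 0, so the quotient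
  -- follows the convention `1/Γ = 0` there.
  have hE : ∀ ρ : ℂ, mittagLefflerMellin lam ρ =
      Real.pi / (Complex.sin (Real.pi * ρ) * Complex.Gamma (1 - ρ * lam)) := fun ρ => by
    rw [mittagLefflerMellin, mul_comm (lam : ℂ), ← div_eq_mul_inv, div_div]
  have hprod : mittagLefflerMellin lam r * mittagLefflerMellin lam s =
      (Real.pi : ℂ) ^ 2 / (Complex.sin (Real.pi * r) * Complex.sin (Real.pi * s) *
        Complex.Gamma (1 - r * lam) * Complex.Gamma (1 - s * lam)) := by
    rw [hE, hE, div_mul_div_comm]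
    ring_nf
  refine ⟨fun p q hp hq => ?_, fun hlt => ?_, fun hcase hsr hss => ?_, fun h1 => ?_⟩
  · have h := extConfluent_eq_integral (σ := σ) (τ := τ) (z := z) hlam hlam_le hη₂ hη₃ hp hq
    exact ⟨h.1, h.2.1⟩
  · rcases hstrip with rfl | ⟨hr1, hs1⟩
    · exact (doubleMellin_extConfluent_of_hasMellin hlam hlam_le hσ hτ hη₂ hη₃ hr hs
        (hasMellin_mittagLeffler_one hr) (hasMellin_mittagLeffler_one hs)).1
    · exact (doubleMellin_extConfluent_of_hasMellin hlam hlam_le hσ hτ hη₂ hη₃ hr hs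
        (hasMellin_mittagLeffler_neg hlam hlt hr hr1)
        (hasMellin_mittagLeffler_neg hlam hlt hs hs1)).1
  · rw [← hprod]
    rcases hlam_le.eq_or_lt with rfl | hlt
    · exact doubleMellin_extConfluent_two hσ hτ hη₂ hη₃ hr hs hsr hss
        (hcase.resolve_left (lt_irrefl _))
    · rcases hstrip with rfl | ⟨hr1, hs1⟩
      -- For `lam = 1` the real parts may exceed 1, outside the Mellin–Barnes strip; the transform
      -- `Γ` of `e^(-x)` is used instead and matches by reflection.
      · rw [mittagLefflerMellin_one hr hsr, mittagLefflerMellin_one hs hss]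
        exact (doubleMellin_extConfluent_of_hasMellin hlam hlam_le hσ hτ hη₂ hη₃ hr hs
          (hasMellin_mittagLeffler_one hr) (hasMellin_mittagLeffler_one hs)).2
      · exact (doubleMellin_extConfluent_of_hasMellin hlam hlam_le hσ hτ hη₂ hη₃ hr hs
          (hasMellin_mittagLeffler_neg hlam hlt hr hr1)
          (hasMellin_mittagLeffler_neg hlam hlt hs hs1)).2
  · subst h1
    exact (doubleMellin_extConfluent_of_hasMellin hlam hlam_le hσ hτ hη₂ hη₃ hr hs
      (hasMellin_mittagLeffler_one hr) (hasMellin_mittagLeffler_one hs)).2
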